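/- Let $M$ be a smooth manifold of dimension $n+1$ and $\pi:M\to\mathbb R$ a fibration (a smooth surjective submersion), and put $\eta=\pi^*(dt)$. Let $V^*\pi$ be the dual of the vertical bundle $V\pi=\ker T\pi$, let $\mu:T^*M\to V^*\pi$ be the canonical projection, and let $\pi_1^*:V^*\pi\to\mathbb R$ and $\tilde\pi_M:T^*M\to\mathbb R$ be the induced projections to $\mathbb R$. Local coordinates $(t,q^i)$ on $M$ adapted to $\pi$ (the first coordinate being $\pi$) induce coordinates $(t,q^i,p,p_i)$ on $T^*M$ and $(t,q^i,p_i)$ on $V^*\pi$. Let $h:V^*\pi\to T^*M$ be a Hamiltonian section, i.e. a smooth section of $\mu$, locally $h(t,q^i,p_i)=(t,q^i,-H(t,q^i,p_i),p_i)$, and let $F_h:T^*M\to\mathbb R$ be the function determined by $\alpha=h(\mu(\alpha))+F_h(\alpha)\,\eta$, locally $F_h=p+H$. The Hamilton equations for $h$ are, in all adapted coordinates, $\frac{dq^i}{dt}=\frac{\partial H}{\partial p_i}$, $\frac{dp_i}{dt}=-\frac{\partial H}{\partial q^i}$. Let $\Omega_M=-d\theta_M$ be the canonical symplectic form of $T^*M$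 ($\theta_M$ the Liouville form), and let $J^1\tilde\pi_M$ be the manifold of 1-jets of local sections of $\tilde\pi_M$, identified with $\{z\in T(T^*M): (\tilde\pi_M^*dt)(z)=1\}$ and with induced coordinates $(t,q^i,p,p_i;\dot q^i,\dot p,\dot p_i)$. It carries the presymplectic form $\Omega_{J^1\tilde\pi_M}$ obtained by restricting the complete lift $\Omega_M^c$ of $\Omega_M$ to $T(T^*M)$. Let $\tilde b_\pi:J^1\tilde\pi_M\to T^*(T^*M)$, $\tilde b_\pi(z)=\Omega_M(z,\cdot)$, and $\tilde S_h=\tilde b_\pi^{-1}(dF_h(T^*M))\subseteq J^1\tilde\pi_M$. A submanifold $C$ of a manifold with a presymplectic form $\omega$ is called Lagrangian if $\omega$ vanishes on $C$ and $\dim C=\frac12\operatorname{rank}\omega(x)+\dim\big(T_xC\cap\ker\omega(x)\big)$ for all $x\in C$. Theorem. 1. A section $\tau$ of $\pi_1^*:V^*\pi\to\mathbb R$ (defined on $\mathbb R$, or more generally on an open subset of $\mathbb R$) is a solution of the Hamilton equations for $h$ if and only if $$\tilde b_\pi\circ j^1(h\circ\tau)=dF_h\circ h\circ\tau .$$ 2.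 $\tilde S_h$ is a Lagrangian submanifold of $(J^1\tilde\pi_M,\Omega_{J^1\tilde\pi_M})$, and the local equations which define it are the Hamilton equations for $h$ together with the accompanying equation for $p$: over the domain of any adapted coordinates, the functions $$\dot q^i-\frac{\partial H}{\partial p_i},\qquad \dot p_i+\frac{\partial H}{\partial q^i},\qquad \dot p+\frac{\partial H}{\partial t}$$ on $J^1\tilde\pi_M$ are smooth, $\tilde S_h$ is their common zero set, and their differentials are linearly independent at the points of $\tilde S_h$. -/

import Mathlib

open scoped Manifold ContDiff

noncomputable section

namespace TimeDep

open Set Filter Topology Bundle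

/-- The model space `ℝⁿ⁺¹` of an `(n+1)`-dimensional manifold. -/
abbrev Model (n : ℕ) : Type := EuclideanSpace ℝ (Fin (n + 1))

/-- The model `ℝⁿ` of the fibres of `V*π`. -/
abbrev Momenta (n : ℕ) : Type := EuclideanSpace ℝ (Fin n)

theorem exists_linear {n : ℕ} (l : Model n →L[ℝ] ℝ) (hl : l ≠ 0) :
    ∃ A : Model n ≃L[ℝ] Model n, ∀ v, A v 0 = l v := by
  obtain ⟨k, hk⟩ : ∃ k, l (EuclideanSpace.single k 1) ≠ 0 := by
    by_contra! h
    apply hl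
    ext v
    have : v = ∑ j, v j • EuclideanSpace.single j (1 : ℝ) := by
      ext i; simp [Pi.single_apply]
    rw [this, map_sum]
    simp [h]
  let A₀ : Model n →ₗ[ℝ] Model n :=
    { toFun := fun v => WithLp.toLp 2 (Fin.cons (l v) fun i => v (k.succAbove i))
      map_add' := fun v w => by
        ext i; refine Fin.cases ?_ (fun i => ?_) i <;> simp
      map_smul' := fun c v => by
        ext i; refine Fin.cases ?_ (fun i => ?_) i <;> simp }
  have hA₀ : Function.Injective A₀ := by
    rw [injective_iff_map_eq_zero]
    intro v hv
    have h0 : l v = 0 := by simpa [A₀] using congrArg (fun w : Model n => w 0) hv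
    have h1 : ∀ i, v (k.succAbove i) = 0 := fun i => by
      simpa [A₀] using congrArg (fun w : Model n => w i.succ) hv
    have h2 : v = v k • EuclideanSpace.single k (1 : ℝ) := by
      ext j
      rcases eq_or_ne j k with rfl | hj
      · simp
      · obtain ⟨i, rfl⟩ := Fin.exists_succAbove_eq hj
        simp [h1, hj]
    rw [h2, map_smul, smul_eq_mul] at h0
    rw [h2, (mul_eq_zero.1 h0).resolve_right hk, zero_smul]
  refine ⟨(LinearEquiv.ofInjectiveEndo A₀ hA₀).toContinuousLinearEquiv, fun v => ?_⟩
  simp [A₀]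

theorem exists_straightening {n : ℕ} {f : Model n → ℝ} {s : Set (Model n)} (hs : IsOpen s)
    (hf : ContDiffOn ℝ ∞ f s) {y : Model n} (hy : y ∈ s) (hd : fderiv ℝ f y ≠ 0) :
    ∃ G : OpenPartialHomeomorph (Model n) (Model n), y ∈ G.source ∧ G.source ⊆ s ∧
      ContDiffOn ℝ ∞ G G.source ∧ ContDiffOn ℝ ∞ G.symm G.target ∧
      ∀ z ∈ G.source, G z 0 = f z := by
  obtain ⟨A, hA⟩ := exists_linear _ hd
  let g : Model n → Model n := fun z => A z + (f z - A z 0) • EuclideanSpace.single 0 (1 : ℝ)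
  have hg0 : ∀ z, g z 0 = f z := fun z => by simp [g]
  have hg : ContDiffOn ℝ ∞ g s := by
    refine A.contDiff.contDiffOn.add ((hf.sub ?_).smul contDiffOn_const)
    exact ((EuclideanSpace.proj (𝕜 := ℝ) (0 : Fin (n + 1))).contDiff.comp A.contDiff).contDiffOn
  have hgA : HasFDerivAt g (A : Model n →L[ℝ] Model n) y := by
    have h1 := ((hf.contDiffAt (hs.mem_nhds hy)).differentiableAt (by simp)).hasFDerivAt
    have h2 : HasFDerivAt (fun z => A z 0) (fderiv ℝ f y) y := by
      have h := ((EuclideanSpace.proj (𝕜 := ℝ) (0 : Fin (n + 1))).comp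
        (A : Model n →L[ℝ] Model n)).hasFDerivAt (x := y)
      exact h.congr_fderiv (ContinuousLinearMap.ext fun v => hA v)
    have h3 := A.hasFDerivAt (x := y) |>.add
      ((h1.sub h2).smul_const (EuclideanSpace.single (0 : Fin (n + 1)) (1 : ℝ)))
    refine h3.congr_fderiv (ContinuousLinearMap.ext fun v => ?_)
    simp
  let G₀ := (hg.contDiffAt (hs.mem_nhds hy)).toOpenPartialHomeomorph g hgA (by simp)
  have hyG : y ∈ G₀.source := (hg.contDiffAt (hs.mem_nhds hy)).mem_toOpenPartialHomeomorph_source hgA (by simp)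
  let u : Set (Model n) := s ∩ fderiv ℝ g ⁻¹' range ((↑) : (Model n ≃L[ℝ] Model n) → _)
  have hu : IsOpen u := (hg.continuousOn_fderiv_of_isOpen hs (by simp)).isOpen_inter_preimage hs
    ContinuousLinearEquiv.isOpen
  refine ⟨G₀.restrOpen u hu, ⟨hyG, hy, A, hgA.fderiv.symm⟩, ?_, ?_, ?_, ?_⟩
  · intro z hz; exact hz.2.1
  · exact hg.mono fun z hz => hz.2.1
  · intro z hz
    have hz' : G₀.symm z ∈ u := by
      have := (G₀.restrOpen u hu).map_target hz
      exact this.2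
    obtain ⟨B, hB⟩ := hz'.2
    have hzs := hg.contDiffAt (hs.mem_nhds hz'.1)
    refine ((G₀.restrOpen u hu).contDiffAt_symm (f₀' := B) hz ?_ hzs).contDiffWithinAt
    rw [hB]
    exact (hzs.differentiableAt (by simp)).hasFDerivAt
  · intro z hz; exact hg0 z

section Forms

variable {E H N : Type*} [NormedAddCommGroup E] [NormedSpace ℝ E] [TopologicalSpace H]
  {I : ModelWithCorners ℝ E H} [TopologicalSpace N] [ChartedSpace H N]

variable (I N) in
/-- The cotangent bundle of `N`. -/
abbrev CotangentBundle : Type _ :=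
  TotalSpace (E →L[ℝ] ℝ) (fun x : N => TangentSpace I x →L[ℝ] ℝ)

/-- The bilinear form `(v, w) ↦ B (S v) (T w)`. -/
def pull {V W : Type*} [AddCommGroup V] [Module ℝ V] [TopologicalSpace V]
    [IsTopologicalAddGroup V] [ContinuousSMul ℝ V] [AddCommGroup W] [Module ℝ W]
    [TopologicalSpace W] [IsTopologicalAddGroup W] [ContinuousSMul ℝ W]
    (S T : V →L[ℝ] W) (B : W →L[ℝ] W →L[ℝ] ℝ) : V →L[ℝ] V →L[ℝ] ℝ :=
  (ContinuousLinearMap.precomp ℝ T).comp (B.comp S)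

/-- The exterior derivative `dθ` of a 1-form `θ` on a manifold without boundary, computed at `x` in
the chart at `x`: `dθ(v, w) = D_v θ(w) - D_w θ(v)`. -/
def extDerivOne (θ : ∀ x : N, TangentSpace I x →L[ℝ] ℝ) (x : N) :
    TangentSpace I x →L[ℝ] TangentSpace I x →L[ℝ] ℝ :=
  let e := extChartAt I x
  let θe : E → E →L[ℝ] ℝ := fun y => (θ (e.symm y)).comp (mfderiv 𝓘(ℝ, E) I e.symm y)
  let D : E →L[ℝ] E →L[ℝ] ℝ := fderiv ℝ θe (e x)
  pull (mfderiv I 𝓘(ℝ, E) e x) (mfderiv I 𝓘(ℝ, E) e x) (D - D.flip)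

/-- The complete lift to `TN` of a 2-form `B` on a manifold `N` without boundary. In the
coordinates `(x, v)` of `TN` induced by a chart of `N`, if `B = ∑ Bᵢⱼ dxⁱ ⊗ dxʲ` then
`Bᶜ = ∑ vᵏ (∂ₖ Bᵢⱼ) dxⁱ ⊗ dxʲ + Bᵢⱼ dvⁱ ⊗ dxʲ + Bᵢⱼ dxⁱ ⊗ dvʲ`. -/
def completeLift [IsManifold I 1 N] (B : ∀ x : N, TangentSpace I x →L[ℝ] TangentSpace I x →L[ℝ] ℝ)
    (z : TangentBundle I N) :
    TangentSpace I.tangent z →L[ℝ] TangentSpace I.tangent z →L[ℝ] ℝ :=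
  let e := extChartAt I z.1
  let Be : E → E →L[ℝ] E →L[ℝ] ℝ := fun y =>
    pull (mfderiv 𝓘(ℝ, E) I e.symm y) (mfderiv 𝓘(ℝ, E) I e.symm y) (B (e.symm y))
  let x : E := (extChartAt I.tangent z z).1
  let v : E := (extChartAt I.tangent z z).2
  let T : TangentSpace I.tangent z →L[ℝ] E × E :=
    mfderiv I.tangent 𝓘(ℝ, E × E) (extChartAt I.tangent z) z
  let dx : TangentSpace I.tangent z →L[ℝ] E := (ContinuousLinearMap.fst ℝ E E).comp T
  let dv : TangentSpace I.tangent z →L[ℝ] E := (ContinuousLinearMap.snd ℝ E E).comp T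
  pull dx dx (fderiv ℝ Be x v) + pull dv dx (Be x) + pull dx dv (Be x)

/-- The Liouville 1-form of the cotangent bundle. -/
def liouville [IsManifold I 1 N] (α : CotangentBundle N I) :
    TangentSpace (I.prod 𝓘(ℝ, E →L[ℝ] ℝ)) α →L[ℝ] ℝ :=
  α.2.comp (mfderiv (I.prod 𝓘(ℝ, E →L[ℝ] ℝ)) I
    (TotalSpace.proj : CotangentBundle N I → N) α)

/-- The canonical symplectic form `Ω = -dθ` of the cotangent bundle (`∑ dqⁱ ∧ dpᵢ` in
coordinates). -/
def canonicalForm [IsManifold I 1 N] (α : CotangentBundle N I) :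
    TangentSpace (I.prod 𝓘(ℝ, E →L[ℝ] ℝ)) α →L[ℝ]
      TangentSpace (I.prod 𝓘(ℝ, E →L[ℝ] ℝ)) α →L[ℝ] ℝ :=
  -extDerivOne liouville α

end Forms

section Jets

variable {E H N : Type*} [NormedAddCommGroup E] [NormedSpace ℝ E] [TopologicalSpace H]
  (I : ModelWithCorners ℝ E H) [TopologicalSpace N] [ChartedSpace H N]

/-- The function `ḟ = df` on the tangent bundle induced by a function `f`. -/
def dot (f : N → ℝ) (z : TangentBundle I N) : ℝ := mfderiv I 𝓘(ℝ, ℝ) f z.1 z.2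

/-- The space `J¹q` of 1-jets of local sections of `q : N → ℝ`, identified with the submanifold
`{z | (q^*dt)(z) = 1}` of the tangent bundle. -/
def J1 (q : N → ℝ) : Set (TangentBundle I N) := {z | dot I q z = 1}

/-- Smooth local sections of `q : N → ℝ`, defined on open subsets of `ℝ`. -/
structure LocalSection (q : N → ℝ) where
  dom : Set ℝ
  isOpen_dom : IsOpen dom
  toFun : ℝ → N
  contMDiffOn : ContMDiffOn 𝓘(ℝ, ℝ) I ∞ toFun dom
  section_eq : ∀ t ∈ dom, q (toFun t) = t

variable {I}

/-- The velocity vector of a curve. -/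
def velocity (γ : ℝ → N) (t : ℝ) : TangentBundle I N := ⟨γ t, mfderiv 𝓘(ℝ, ℝ) I γ t (1 : ℝ)⟩

theorem LocalSection.velocity_mem {q : N → ℝ} (hq : ContMDiff I 𝓘(ℝ, ℝ) ∞ q)
    (σ : LocalSection I q) (t : σ.dom) : velocity σ.toFun t ∈ J1 I q := by
  have h1 := ((σ.contMDiffOn.contMDiffAt (σ.isOpen_dom.mem_nhds t.2)).mdifferentiableAt
    (by simp)).hasMFDerivAt
  have h2 := (hq.mdifferentiable (by simp) (σ.toFun t)).hasMFDerivAt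
  have h3 : (id : ℝ → ℝ) =ᶠ[𝓝 (t : ℝ)] q ∘ σ.toFun := by
    filter_upwards [σ.isOpen_dom.mem_nhds t.2] with s hs
    exact (σ.section_eq s hs).symm
  have h4 := ((h2.comp (t : ℝ) h1).congr_of_eventuallyEq h3).mfderiv
  rw [mfderiv_id] at h4
  exact (DFunLike.congr_fun h4 (1 : ℝ)).symm

/-- The first jet prolongation `j¹σ` of a local section. -/
def LocalSection.jet {q : N → ℝ} (hq : ContMDiff I 𝓘(ℝ, ℝ) ∞ q) (σ : LocalSection I q)
    (t : σ.dom) : J1 I q := ⟨velocity σ.toFun t, σ.velocity_mem hq t⟩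

end Jets

section Lagrangian

variable {E H N : Type*} [NormedAddCommGroup E] [NormedSpace ℝ E] [TopologicalSpace H]
  (I : ModelWithCorners ℝ E H) [TopologicalSpace N] [ChartedSpace H N]

/-- The tangent space at `z` of a regular level set of `g`. -/
def levelTangent (g : N → ℝ) (z : N) : Submodule ℝ (TangentSpace I z) :=
  LinearMap.ker (mfderiv I 𝓘(ℝ, ℝ) g z).toLinearMap

/-- The tangent space at `z` of a submanifold `S`, spanned by the velocities of the smooth curves
in `S` through `z`. -/
def curveTangent (S : Set N) (z : N) : Submodule ℝ (TangentSpace I z) :=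
  Submodule.span ℝ {w | ∃ c : ℝ → N, ContMDiffAt 𝓘(ℝ, ℝ) I ∞ c 0 ∧ (∀ᶠ r in 𝓝 0, c r ∈ S) ∧
    velocity c 0 = (⟨z, w⟩ : TangentBundle I N)}

/-- `f = 0` are equations on the open set `U` which define `S` as a submanifold of the regular
level set `{g = 1}`: the functions `f` are smooth on `U`, their zeros in `U ∩ {g = 1}` are the
points of `S` in `U`, and at those points their differentials are independent on `{g = 1}`. -/
structure DefiningEquations {κ : Type} [Fintype κ] (g : N → ℝ) (S : Set N) (U : Set N)
    (f : N → κ → ℝ) : Prop where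
  isOpen : IsOpen U
  smooth : ContMDiffOn I 𝓘(ℝ, κ → ℝ) ∞ f U
  mem_iff : ∀ z ∈ U, z ∈ S ↔ g z = 1 ∧ f z = 0
  independent : ∀ z ∈ S ∩ U, ∀ c : κ → ℝ, ∃ w ∈ levelTangent I g z,
    mfderiv I 𝓘(ℝ, κ → ℝ) f z w = c

/-- The linear map `v ↦ B(v, ·)` of a subspace to its dual induced by a bilinear form. -/
def flatOn {x : N} (B : TangentSpace I x →L[ℝ] TangentSpace I x →L[ℝ] ℝ)
    (W : Submodule ℝ (TangentSpace I x)) : W →ₗ[ℝ] (W →L[ℝ] ℝ) :=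
  (pull W.subtypeL W.subtypeL B).toLinearMap

/-- `S` is a Lagrangian submanifold of the presymplectic manifold given by the regular level set
`{g = 1}` and the restriction to it of the 2-form `B`: it is a submanifold, `B` vanishes on it, and
`dim S = rank B / 2 + dim (TS ∩ Ker B)`, the rank and the kernel being those of the restriction
of `B` to `{g = 1}`. -/
structure IsLagrangianSubmanifold (g : N → ℝ)
    (B : ∀ x : N, TangentSpace I x →L[ℝ] TangentSpace I x →L[ℝ] ℝ) (S : Set N) : Prop where
  subset : ∀ z ∈ S, g z = 1
  submanifold : ∀ z ∈ S, ∃ U : Set N, z ∈ U ∧ ∃ (k : ℕ) (f : N → Fin k → ℝ),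
    DefiningEquations I g S U f
  isotropic : ∀ z ∈ S, ∀ v ∈ curveTangent I S z, ∀ w ∈ curveTangent I S z, B z v w = 0
  dim_eq : ∀ z ∈ S, 2 * Module.finrank ℝ (curveTangent I S z) =
    Module.finrank ℝ (LinearMap.range (flatOn I (B z) (levelTangent I g z))) +
      2 * Module.finrank ℝ (curveTangent I S z ⊓
        (LinearMap.ker (flatOn I (B z) (levelTangent I g z))).map
          (levelTangent I g z).subtype : Submodule ℝ (TangentSpace I z))

end Lagrangian

section Fibration

variable (n : ℕ) (M : Type*) [TopologicalSpace M] [ChartedSpace (Model n) M]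

/-- A fibration `π : M → ℝ` : a smooth surjective submersion. -/
structure Fibration where
  toFun : M → ℝ
  contMDiff : ContMDiff (𝓡 (n + 1)) 𝓘(ℝ, ℝ) ∞ toFun
  surjective : Function.Surjective toFun
  submersion : ∀ x, Function.Surjective (mfderiv (𝓡 (n + 1)) 𝓘(ℝ, ℝ) toFun x)

end Fibration

variable {n : ℕ} {M : Type*} [TopologicalSpace M] [ChartedSpace (Model n) M]

namespace Fibration

variable (P : Fibration n M)

/-- The covector `η(x) = (π^*dt)(x)`. -/
def dt (x : M) : TangentSpace (𝓡 (n + 1)) x →L[ℝ] ℝ :=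
  mfderiv (𝓡 (n + 1)) 𝓘(ℝ, ℝ) P.toFun x

/-- The fibre at `x` of the vertical bundle `Vπ`. -/
def Vert (x : M) : Submodule ℝ (TangentSpace (𝓡 (n + 1)) x) := LinearMap.ker (P.dt x).toLinearMap

/-- The fibre at `x` of the dual bundle `V*π` of the vertical bundle. -/
abbrev VDual (x : M) : Type := P.Vert x →L[ℝ] ℝ

/-- The total space of the bundle `V*π → M`. -/
abbrev VStar : Type _ := TotalSpace (Momenta n) P.VDual

/-- The restriction of a covector to the vertical subspace. -/
def restr (x : M) : (TangentSpace (𝓡 (n + 1)) x →L[ℝ] ℝ) →ₗ[ℝ] P.VDual x where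
  toFun α := α.comp (P.Vert x).subtypeL
  map_add' _ _ := rfl
  map_smul' _ _ := rfl

theorem restr_apply (x : M) (α : TangentSpace (𝓡 (n + 1)) x →L[ℝ] ℝ) (v : P.Vert x) :
    P.restr x α v = α v := rfl

/-- A chart of the smooth manifold `M` with coordinates `(t, qⁱ)` adapted to the fibration: its
`0`-th coordinate is `π`. -/
structure AdaptedChart where
  chart : OpenPartialHomeomorph M (Model n)
  mem_maximalAtlas : chart ∈ IsManifold.maximalAtlas (𝓡 (n + 1)) ∞ M
  time_eq : ∀ x ∈ chart.source, chart x 0 = P.toFun x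

namespace AdaptedChart

variable {P} (φ : P.AdaptedChart)

/-- The coframe `(dt, dqⁱ)` at `x`, as a linear map to `ℝⁿ⁺¹`. -/
def coframe (x : M) : TangentSpace (𝓡 (n + 1)) x →L[ℝ] Model n :=
  mfderiv (𝓡 (n + 1)) (𝓡 (n + 1)) φ.chart x

/-- The frame `(∂/∂t, ∂/∂qⁱ)` at `x` (meaningful for `x` in the domain of the chart). -/
def frame (x : M) (j : Fin (n + 1)) : TangentSpace (𝓡 (n + 1)) x :=
  (φ.coframe x).inverse (EuclideanSpace.single j 1)

theorem contMDiffOn : ContMDiffOn (𝓡 (n + 1)) (𝓡 (n + 1)) ∞ φ.chart φ.chart.source :=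
  contMDiffOn_of_mem_maximalAtlas φ.mem_maximalAtlas

theorem mdifferentiable : φ.chart.MDifferentiable (𝓡 (n + 1)) (𝓡 (n + 1)) :=
  ⟨(contMDiffOn_of_mem_maximalAtlas φ.mem_maximalAtlas).mdifferentiableOn (by simp),
    (contMDiffOn_symm_of_mem_maximalAtlas φ.mem_maximalAtlas).mdifferentiableOn (by simp)⟩

theorem isInvertible_coframe {x : M} (hx : x ∈ φ.chart.source) : (φ.coframe x).IsInvertible :=
  ⟨φ.mdifferentiable.mfderiv hx, rfl⟩

theorem coframe_frame {x : M} (hx : x ∈ φ.chart.source) (j : Fin (n + 1)) :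
    φ.coframe x (φ.frame x j) = EuclideanSpace.single j 1 :=
  (φ.isInvertible_coframe hx).self_apply_inverse _

theorem coframe_injective {x : M} (hx : x ∈ φ.chart.source) :
    Function.Injective (φ.coframe x) :=
  (φ.isInvertible_coframe hx).injective

theorem dt_eq {x : M} (hx : x ∈ φ.chart.source) (v : TangentSpace (𝓡 (n + 1)) x) :
    P.dt x v = φ.coframe x v 0 := by
  have h1 : P.toFun =ᶠ[𝓝 x] fun y => (EuclideanSpace.proj (𝕜 := ℝ) (0 : Fin (n + 1))) (φ.chart y) := by
    filter_upwards [φ.chart.open_source.mem_nhds hx] with y hy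
    simp [φ.time_eq y hy]
  have h2 := (φ.mdifferentiable.mdifferentiableAt hx).hasMFDerivAt
  have h3 := ((EuclideanSpace.proj (𝕜 := ℝ) (0 : Fin (n + 1))).hasMFDerivAt
    (x := φ.chart x)).comp x h2
  have h4 := (h3.congr_of_eventuallyEq h1).mfderiv
  unfold Fibration.dt
  rw [h4]
  rfl

theorem frame_mem {x : M} (hx : x ∈ φ.chart.source) (i : Fin n) :
    φ.frame x i.succ ∈ P.Vert x := by
  have := φ.dt_eq hx (φ.frame x i.succ)
  rw [φ.coframe_frame hx] at this
  simpa [Vert] using this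

open Classical in
/-- The frame `∂/∂qⁱ` of the vertical bundle over the domain of the chart. -/
def vframe (x : M) (i : Fin n) : P.Vert x :=
  if hx : x ∈ φ.chart.source then ⟨φ.frame x i.succ, φ.frame_mem hx i⟩ else 0

/-- The coordinates `(pᵢ)` of an element of `V*π` over the domain of the chart. -/
def momenta (β : P.VStar) : Momenta n := WithLp.toLp 2 fun i => β.2 (φ.vframe β.1 i)

/-- The element of `V*π` over `x` with coordinates `(pᵢ)`. -/
def ofMomenta (x : M) (p : Momenta n) : P.VDual x :=
  P.restr x (∑ i : Fin n, p i • (EuclideanSpace.proj (𝕜 := ℝ) i.succ).comp (φ.coframe x))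

theorem ofMomenta_apply (x : M) (p : Momenta n) (v : P.Vert x) :
    φ.ofMomenta x p v = ∑ i : Fin n, p i * φ.coframe x v i.succ := by
  simp [ofMomenta, restr_apply]

theorem momenta_ofMomenta {x : M} (hx : x ∈ φ.chart.source) (p : Momenta n) :
    φ.momenta ⟨x, φ.ofMomenta x p⟩ = p := by
  ext j
  simp [momenta, ofMomenta_apply, vframe, hx, coframe_frame]

theorem ofMomenta_momenta {x : M} (hx : x ∈ φ.chart.source) (β : P.VDual x) :
    φ.ofMomenta x (φ.momenta ⟨x, β⟩) = β := by
  ext v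
  have hv : v = ∑ i : Fin n, φ.coframe x v i.succ • φ.vframe x i := by
    apply Subtype.ext
    apply φ.coframe_injective hx
    have h0 : φ.coframe x v 0 = 0 := by rw [← φ.dt_eq hx]; exact v.2
    rw [Submodule.coe_sum, map_sum]
    ext j
    refine Fin.cases ?_ (fun j => ?_) j
    · simp [vframe, hx, coframe_frame, h0]
    · simp [vframe, hx, coframe_frame, Pi.single_apply]
  conv_rhs => rw [hv, map_sum]
  rw [ofMomenta_apply]
  simp [momenta, mul_comm]

/-- The pretrivialization `β ↦ (x, pᵢ)` of `V*π` given by an adapted chart. -/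
def pretriv : Pretrivialization (Momenta n) (π (Momenta n) P.VDual) where
  toFun β := (β.1, φ.momenta β)
  invFun y := ⟨y.1, φ.ofMomenta y.1 y.2⟩
  source := π (Momenta n) P.VDual ⁻¹' φ.chart.source
  target := φ.chart.source ×ˢ univ
  map_source' β hβ := ⟨hβ, mem_univ _⟩
  map_target' y hy := hy.1
  left_inv' := by
    rintro ⟨x, β⟩ hβ
    exact congrArg (TotalSpace.mk x) (φ.ofMomenta_momenta hβ β)
  right_inv' := by
    rintro ⟨x, p⟩ hp
    exact Prod.ext rfl (φ.momenta_ofMomenta hp.1 p)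
  open_target := φ.chart.open_source.prod isOpen_univ
  baseSet := φ.chart.source
  open_baseSet := φ.chart.open_source
  source_eq := rfl
  target_eq := rfl
  proj_toFun _ _ := rfl

/-- The Jacobian coefficients of the coframe of `φ` on the frame of `ψ`. -/
theorem contMDiffOn_coframe_frame (φ ψ : P.AdaptedChart) (j k : Fin (n + 1)) :
    ContMDiffOn (𝓡 (n + 1)) 𝓘(ℝ, ℝ) ∞ (fun x => φ.coframe x (ψ.frame x j) k)
      (φ.chart.source ∩ ψ.chart.source) := by
  have hcd : ContDiffOn ℝ ∞ (φ.chart ∘ ψ.chart.symm) (ψ.chart.symm.trans φ.chart).source := by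
    rw [← contMDiffOn_iff_contDiffOn]
    refine φ.contMDiffOn.comp
      ((contMDiffOn_symm_of_mem_maximalAtlas ψ.mem_maximalAtlas).mono ?_) ?_
    · intro y hy; simp at hy; exact hy.1
    · intro y hy; simp at hy; exact hy.2
  have hd : ContDiffOn ℝ ∞ (fderiv ℝ (φ.chart ∘ ψ.chart.symm))
      (ψ.chart.symm.trans φ.chart).source :=
    hcd.fderiv_of_isOpen (ψ.chart.symm.trans φ.chart).open_source (by simp)
  have hd' : ContMDiffOn (𝓡 (n + 1)) 𝓘(ℝ, Model n →L[ℝ] Model n) ∞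
      (fun x => fderiv ℝ (φ.chart ∘ ψ.chart.symm) (ψ.chart x))
      (φ.chart.source ∩ ψ.chart.source) := by
    refine (contMDiffOn_iff_contDiffOn.mpr hd).comp (ψ.contMDiffOn.mono inter_subset_right) ?_
    intro x hx
    simp [hx.1, hx.2]
  have hL : ContMDiff 𝓘(ℝ, Model n →L[ℝ] Model n) 𝓘(ℝ, ℝ) ∞
      (fun A : Model n →L[ℝ] Model n => A (EuclideanSpace.single j 1) k) := by
    rw [contMDiff_iff_contDiff]
    exact ((EuclideanSpace.proj (𝕜 := ℝ) k).comp
      (ContinuousLinearMap.apply ℝ (Model n) (EuclideanSpace.single j (1 : ℝ) : Model n))).contDiff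
  refine (hL.comp_contMDiffOn hd').congr ?_
  intro x hx
  have hx' : ψ.chart x ∈ (ψ.chart.symm.trans φ.chart).source := by simp [hx.1, hx.2]
  have h1 : (φ.chart : M → Model n) =ᶠ[𝓝 x] (φ.chart ∘ ψ.chart.symm) ∘ ψ.chart := by
    filter_upwards [ψ.chart.open_source.mem_nhds hx.2] with y hy
    simp [hy]
  have h2 := (ψ.mdifferentiable.mdifferentiableAt hx.2).hasMFDerivAt
  have h3 : DifferentiableAt ℝ (φ.chart ∘ ψ.chart.symm) (ψ.chart x) :=
    (hcd.contDiffAt ((ψ.chart.symm.trans φ.chart).open_source.mem_nhds hx')).differentiableAt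
      (by simp)
  have h4 := (h3.hasFDerivAt.hasMFDerivAt.comp x h2).congr_of_eventuallyEq h1
  have h5 : φ.coframe x = (fderiv ℝ (φ.chart ∘ ψ.chart.symm) (ψ.chart x)).comp (ψ.coframe x) :=
    h4.mfderiv
  simp [h5, ψ.coframe_frame hx.2]

/-- Transition functions of the pretrivializations. -/
def transition (φ ψ : P.AdaptedChart) (x : M) : Momenta n →L[ℝ] Momenta n :=
  ∑ i : Fin n, ∑ j : Fin n, φ.coframe x (ψ.frame x j.succ) i.succ •
    (EuclideanSpace.proj (𝕜 := ℝ) i).smulRight (EuclideanSpace.single j (1 : ℝ))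

theorem transition_apply (φ ψ : P.AdaptedChart) {x : M}
    (hx : x ∈ φ.pretriv.baseSet ∩ ψ.pretriv.baseSet) (p : Momenta n) :
    transition φ ψ x p = (ψ.pretriv ⟨x, φ.pretriv.symm x p⟩).2 := by
  have h1 : φ.pretriv.symm x p = φ.ofMomenta x p := by
    rw [Pretrivialization.symm_apply _ hx.1]
    rfl
  rw [h1]
  change transition φ ψ x p = ψ.momenta ⟨x, φ.ofMomenta x p⟩
  have hx2 : x ∈ ψ.chart.source := hx.2
  ext j
  simp [transition, momenta, ofMomenta_apply, vframe, hx2, Finset.sum_apply,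
    Pi.single_apply, mul_comm]

theorem contMDiffOn_transition (φ ψ : P.AdaptedChart) :
    ContMDiffOn (𝓡 (n + 1)) 𝓘(ℝ, Momenta n →L[ℝ] Momenta n) ∞ (transition φ ψ)
      (φ.chart.source ∩ ψ.chart.source) := by
  unfold transition
  refine contMDiffOn_finsetSum fun i _ => contMDiffOn_finsetSum fun j _ => ?_
  exact (contMDiffOn_coframe_frame φ ψ _ _).smul contMDiffOn_const

instance isLinear_pretriv : φ.pretriv.IsLinear ℝ where
  linear _ _ :=
    { map_add := fun _ _ => rfl
      map_smul := fun _ _ => rfl }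

end AdaptedChart

/-- The cotangent bundle `T*M`. -/
abbrev _root_.TimeDep.TStar (n : ℕ) (M : Type*) [TopologicalSpace M] [ChartedSpace (Model n) M] :
    Type _ := CotangentBundle M (𝓡 (n + 1))

/-- The projection `π̃_M : T*M → ℝ`. -/
def projT (α : TStar n M) : ℝ := P.toFun α.1

/-- The projection `π₁* : V*π → ℝ`. -/
def projV (β : P.VStar) : ℝ := P.toFun β.1

/-- The projection `μ : T*M → V*π`. -/
def mu (α : TStar n M) : P.VStar := ⟨α.1, P.restr α.1 α.2⟩

/-- The principal action of `ℝ` on `T*M`, `(c, α) ↦ α + c η`. -/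
def act (c : ℝ) (α : TStar n M) : TStar n M := ⟨α.1, α.2 + c • P.dt α.1⟩

/-- The orbits of the action are the fibres of `μ`. -/
theorem exists_act_eq {α α' : TStar n M} (hα : P.mu α = P.mu α') : ∃ c : ℝ, α = P.act c α' := by
  obtain ⟨x, a⟩ := α
  obtain ⟨y, b⟩ := α'
  obtain rfl : x = y := congrArg TotalSpace.proj hα
  have hab : P.restr x a = P.restr x b := by simpa [mu] using hα
  obtain ⟨w, hw⟩ : ∃ w, P.dt x w = 1 := P.submersion x (1 : ℝ)
  refine ⟨a w - b w, congrArg (TotalSpace.mk x) ?_⟩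
  ext v
  have hv : v - P.dt x v • w ∈ P.Vert x := by
    change P.dt x (v - P.dt x v • w) = 0
    rw [map_sub, map_smul, hw, smul_eq_mul, mul_one, sub_self]
  have h1 : a (v - P.dt x v • w) = b (v - P.dt x v • w) := DFunLike.congr_fun hab ⟨_, hv⟩
  simp only [map_sub, map_smul, smul_eq_mul] at h1
  change a v = b v + (a w - b w) * P.dt x v
  linarith

section Manifold

variable [IsManifold (𝓡 (n + 1)) ∞ M]

/-- Around every point there are coordinates adapted to the fibration. -/
theorem exists_adaptedChart (x : M) : ∃ φ : P.AdaptedChart, x ∈ φ.chart.source := by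
  let e := chartAt (Model n) x
  have he : e ∈ IsManifold.maximalAtlas (𝓡 (n + 1)) ∞ M := IsManifold.chart_mem_maximalAtlas x
  have hx : x ∈ e.source := mem_chart_source _ x
  have hmd : e.MDifferentiable (𝓡 (n + 1)) (𝓡 (n + 1)) := mdifferentiable_chart x
  have hf : ContDiffOn ℝ ∞ (P.toFun ∘ e.symm) e.target := by
    rw [← contMDiffOn_iff_contDiffOn]
    exact P.contMDiff.comp_contMDiffOn (contMDiffOn_symm_of_mem_maximalAtlas he)
  have hd : fderiv ℝ (P.toFun ∘ e.symm) (e x) ≠ 0 := by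
    intro h0
    have h1 := (hf.contDiffAt (e.open_target.mem_nhds (e.map_source hx))).differentiableAt
      (by simp) |>.hasFDerivAt.hasMFDerivAt.comp x (hmd.mdifferentiableAt hx).hasMFDerivAt
    have h2 : P.toFun =ᶠ[𝓝 x] (P.toFun ∘ e.symm) ∘ e := by
      filter_upwards [e.open_source.mem_nhds hx] with y hy
      simp [hy]
    have h3 := (h1.congr_of_eventuallyEq h2).mfderiv
    obtain ⟨v, hv⟩ := P.submersion x (1 : ℝ)
    rw [h3, h0] at hv
    exact zero_ne_one (α := ℝ) hv
  obtain ⟨G, hxG, hGs, hG, hG', hG0⟩ := exists_straightening e.open_target hf (e.map_source hx) hd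
  refine ⟨⟨e.trans G, ?_, ?_⟩, ?_⟩
  · apply OpenPartialHomeomorph.mem_maximalAtlas_of_contMDiffOn
    · refine (contMDiffOn_iff_contDiffOn.mpr hG).comp
        ((contMDiffOn_of_mem_maximalAtlas he).mono ?_) ?_
      · intro y hy; exact hy.1
      · intro y hy; exact hy.2
    · refine (contMDiffOn_symm_of_mem_maximalAtlas he).comp
        ((contMDiffOn_iff_contDiffOn.mpr hG').mono ?_) ?_
      · intro y hy; exact hy.1
      · intro y hy; exact hy.2
  · intro y hy
    have h1 := hG0 (e y) hy.2
    rw [Function.comp_apply, e.left_inv hy.1] at h1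
    exact h1
  · exact ⟨hx, hxG⟩

/-- An adapted chart around a given point. -/
def adaptedChartAt (x : M) : P.AdaptedChart := (P.exists_adaptedChart x).choose

theorem mem_adaptedChartAt (x : M) : x ∈ (P.adaptedChartAt x).chart.source :=
  (P.exists_adaptedChart x).choose_spec

/-- The vector bundle structure of `V*π → M`: its local trivializations are the maps
`β ↦ (x, pᵢ)` given by the adapted charts. -/
def prebundle : VectorPrebundle ℝ (Momenta n) P.VDual where
  pretrivializationAtlas := range fun φ : P.AdaptedChart => φ.pretriv
  pretrivialization_linear' := by
    rintro _ ⟨φ, rfl⟩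
    exact φ.isLinear_pretriv
  pretrivializationAt x := (P.adaptedChartAt x).pretriv
  mem_base_pretrivializationAt := P.mem_adaptedChartAt
  pretrivialization_mem_atlas x := ⟨_, rfl⟩
  exists_coordChange := by
    rintro _ ⟨φ, rfl⟩ _ ⟨ψ, rfl⟩
    exact ⟨AdaptedChart.transition φ ψ, (AdaptedChart.contMDiffOn_transition φ ψ).continuousOn,
      fun x hx p => AdaptedChart.transition_apply φ ψ hx p⟩
  totalSpaceMk_isInducing x := by
    have hx := P.mem_adaptedChartAt x
    let φ := P.adaptedChartAt x
    let L : P.VDual x ≃ₗ[ℝ] Momenta n :=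
      { toFun := fun β => φ.momenta ⟨x, β⟩
        map_add' := fun _ _ => rfl
        map_smul' := fun _ _ => rfl
        invFun := φ.ofMomenta x
        left_inv := φ.ofMomenta_momenta hx
        right_inv := φ.momenta_ofMomenta hx }
    have : FiniteDimensional ℝ (P.VDual x) := L.symm.finiteDimensional
    have hL : IsInducing L := L.toContinuousLinearEquiv.toHomeomorph.isInducing
    exact (isInducing_const_prod (X := M) (x := x)).mpr hL

instance isContMDiff_prebundle : P.prebundle.IsContMDiff (𝓡 (n + 1)) ∞ where
  exists_contMDiffCoordChange := by
    rintro _ ⟨φ, rfl⟩ _ ⟨ψ, rfl⟩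
    exact ⟨AdaptedChart.transition φ ψ, AdaptedChart.contMDiffOn_transition φ ψ,
      fun x hx p => AdaptedChart.transition_apply φ ψ hx p⟩

instance topologicalSpaceVStar : TopologicalSpace P.VStar := P.prebundle.totalSpaceTopology

instance fiberBundleVStar : FiberBundle (Momenta n) P.VDual := P.prebundle.toFiberBundle

instance vectorBundleVStar : VectorBundle ℝ (Momenta n) P.VDual := P.prebundle.toVectorBundle

instance contMDiffVectorBundleVStar :
    ContMDiffVectorBundle ∞ (Momenta n) P.VDual (𝓡 (n + 1)) :=
  P.prebundle.contMDiffVectorBundle (𝓡 (n + 1))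

/-- The model with corners of `T*M`. -/
abbrev _root_.TimeDep.IT (n : ℕ) := (𝓡 (n + 1)).prod 𝓘(ℝ, Model n →L[ℝ] ℝ)

/-- The model with corners of `V*π`. -/
abbrev _root_.TimeDep.IV (n : ℕ) := (𝓡 (n + 1)).prod 𝓘(ℝ, Momenta n)

theorem contMDiff_projT : ContMDiff (IT n) 𝓘(ℝ, ℝ) ∞ P.projT :=
  P.contMDiff.comp (contMDiff_proj _)

/-- Hamiltonian sections: smooth sections `h : V*π → T*M` of `μ`. -/
structure HamiltonianSection where
  toFun : P.VStar → TStar n M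
  contMDiff : ContMDiff (IV n) (IT n) ∞ toFun
  section_eq : ∀ β, P.mu (toFun β) = β

/-- The isomorphism `b_M : T(T*M) → T*(T*M)`, `v ↦ Ω_M(v, ·)`. -/
def _root_.TimeDep.flatM (z : TangentBundle (IT n) (TStar n M)) :
    CotangentBundle (TStar n M) (IT n) := ⟨z.1, canonicalForm z.1 z.2⟩

/-- The map `b̃_π : J¹π̃_M → T*(T*M)`, the restriction of `b_M`. -/
def flatTilde (z : J1 (IT n) P.projT) : CotangentBundle (TStar n M) (IT n) := flatM z.1

namespace HamiltonianSection

variable {P} (h : P.HamiltonianSection)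

theorem exists_energy (α : TStar n M) : ∃ c : ℝ, α = P.act c (h.toFun (P.mu α)) :=
  P.exists_act_eq (h.section_eq (P.mu α)).symm

/-- The function `F_h` on `T*M`, which is determined by `α = h(μ(α)) + F_h(α) η`. -/
def energy (α : TStar n M) : ℝ := (h.exists_energy α).choose

/-- The differential `dF_h : T*M → T*(T*M)`. -/
def dEnergy (α : TStar n M) : CotangentBundle (TStar n M) (IT n) :=
  ⟨α, mfderiv (IT n) 𝓘(ℝ, ℝ) h.energy α⟩

/-- The subset `S̃_h = b̃_π⁻¹(dF_h(T*M))` of `J¹π̃_M ⊆ T(T*M)`. -/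
def STilde : Set (TangentBundle (IT n) (TStar n M)) :=
  Subtype.val '' (P.flatTilde ⁻¹' range h.dEnergy)

/-- The local section `h ∘ τ` of `π̃_M` defined by a local section `τ` of `π₁*`. -/
def comp (τ : LocalSection (IV n) P.projV) : LocalSection (IT n) P.projT where
  dom := τ.dom
  isOpen_dom := τ.isOpen_dom
  toFun := h.toFun ∘ τ.toFun
  contMDiffOn := h.contMDiff.comp_contMDiffOn τ.contMDiffOn
  section_eq t ht := by
    have h1 : (h.toFun (τ.toFun t)).1 = (τ.toFun t).1 :=
      congrArg TotalSpace.proj (h.section_eq (τ.toFun t))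
    exact (congrArg P.toFun h1).trans (τ.section_eq t ht)

end HamiltonianSection

namespace AdaptedChart

variable {P} (φ : P.AdaptedChart)

/-- The coordinate functions `(t, qⁱ)` on `T*M`. -/
def qT (j : Fin (n + 1)) (α : TStar n M) : ℝ := φ.chart α.1 j

/-- The coordinate functions `(p, pᵢ)` on `T*M`. -/
def pT (j : Fin (n + 1)) (α : TStar n M) : ℝ := α.2 (φ.frame α.1 j)

/-- The coordinates `(t, qⁱ, pᵢ)` on `V*π`. -/
def coordV (β : P.VStar) : Model n × Momenta n := (φ.chart β.1, φ.momenta β)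

/-- The local Hamiltonian `H(t, qⁱ, pᵢ)` with `h(t, qⁱ, pᵢ) = (t, qⁱ, -H(t, qⁱ, pᵢ), pᵢ)`. -/
def ham (h : P.HamiltonianSection) (y : Model n × Momenta n) : ℝ :=
  -φ.pT 0 (h.toFun ⟨φ.chart.symm y.1, φ.ofMomenta (φ.chart.symm y.1) y.2⟩)

/-- `∂H/∂t`. -/
def hamT (h : P.HamiltonianSection) (y : Model n × Momenta n) : ℝ :=
  fderiv ℝ (φ.ham h) y (EuclideanSpace.single 0 1, 0)

/-- `∂H/∂qⁱ`. -/
def hamQ (h : P.HamiltonianSection) (i : Fin n) (y : Model n × Momenta n) : ℝ :=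
  fderiv ℝ (φ.ham h) y (EuclideanSpace.single i.succ 1, 0)

/-- `∂H/∂pᵢ`. -/
def hamP (h : P.HamiltonianSection) (i : Fin n) (y : Model n × Momenta n) : ℝ :=
  fderiv ℝ (φ.ham h) y (0, EuclideanSpace.single i 1)

/-- The part of `T(T*M)` over the domain of the chart. -/
def domTT : Set (TangentBundle (IT n) (TStar n M)) := {z | z.1.1 ∈ φ.chart.source}

/-- The functions `q̇ⁱ - ∂H/∂pᵢ`, `ṗᵢ + ∂H/∂qⁱ` and `ṗ + ∂H/∂t` on `T(T*M)`. -/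
def hamEqs (h : P.HamiltonianSection) (z : TangentBundle (IT n) (TStar n M)) :
    (Fin n ⊕ Fin n) ⊕ Unit → ℝ
  | .inl (.inl i) => dot (IT n) (φ.qT i.succ) z - φ.hamP h i (φ.coordV (P.mu z.1))
  | .inl (.inr i) => dot (IT n) (φ.pT i.succ) z + φ.hamQ h i (φ.coordV (P.mu z.1))
  | .inr _ => dot (IT n) (φ.pT 0) z + φ.hamT h (φ.coordV (P.mu z.1))

end AdaptedChart

/-- `τ` is a solution of the Hamilton equations `dqⁱ/dt = ∂H/∂pᵢ`, `dpᵢ/dt = -∂H/∂qⁱ` for `h`, in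
all adapted coordinates. -/
def HamiltonianSection.IsSolution {P : Fibration n M} (h : P.HamiltonianSection)
    (τ : LocalSection (IV n) P.projV) : Prop :=
  ∀ φ : P.AdaptedChart, ∀ t ∈ τ.dom, (τ.toFun t).1 ∈ φ.chart.source → ∀ i : Fin n,
    HasDerivAt (fun s => φ.chart (τ.toFun s).1 i.succ) (φ.hamP h i (φ.coordV (τ.toFun t))) t ∧
    HasDerivAt (fun s => φ.momenta (τ.toFun s) i) (-φ.hamQ h i (φ.coordV (τ.toFun t))) t

end Manifold

end Fibration
end TimeDep

end

/-!
Over the domain of an adapted chart `φ`, the functions `qⱼ = qT j` and `pⱼ = pT j` (with `q₀ = t`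
and `p₀ = p`) are smooth coordinates on `T*M`, and the Liouville form is `∑ pⱼ dqⱼ`. Hence the
canonical form is `Ω = ∑ dqⱼ ∧ dpⱼ` (`canonicalForm_eq`), its complete lift is
`Ωᶜ = ∑ (dq̇ⱼ ∧ dpⱼ + dqⱼ ∧ dṗⱼ)` (`completeLift_canonicalForm_eq`), and the `4 n + 4` functions
`qⱼ, pⱼ, q̇ⱼ, ṗⱼ` have independent differentials on `T(T*M)` (`exists_tangent_coordTT`).

*Equations.* Since `F_h = p + H`, the equation `Ω(z, ·) = dF_h` for a vector `z` with `ṫ = 1` says,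
by comparison of coefficients, that `q̇ⁱ = ∂H/∂pᵢ`, `ṗᵢ = -∂H/∂qⁱ` and `ṗ = -∂H/∂t`
(`canonicalForm_eq_differential_energy_iff`). These are the equations of `S̃_h`; they are independent
already on the fibres of `T(T*M) → T*M`, as they prescribe the coordinates `q̇ⁱ, ṗᵢ, ṗ`
(`definingEquations_hamEqs`). Along `h ∘ τ` one has `p = -H`, and by the chain rule the equation for
`p` follows from the other ones (`dot_pT_zero`), so that `j¹(h ∘ τ)` takes values in `S̃_h` exactly
when `τ` solves the Hamilton equations (`isSolution_iff`).

*Lagrangian property.* The tangent space of a submanifold given by independent equations is the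
common kernel of their differentials (`DefiningEquations.curveTangent_eq`), by the inverse function
theorem. A vector `v` tangent to `S̃_h` therefore satisfies the linearized equations, in which
`q̇ⱼ, ṗⱼ` are expressed through the Hessian of `H` and the projection of `v` to `V*π`. Substituted
into `Ωᶜ(v, w)` they give a difference `D²H(x, y) - D²H(y, x)`, which is zero (`sum_wedge_eq_zero`).
On the hyperplane `dṫ = 0` of dimension `4 n + 3`, the kernel of `Ωᶜ` is the line spanned by `∂/∂p`,
and it is tangent to `S̃_h` because the equations do not involve `p`. So the rank is `4 n + 2`, and
`dim S̃_h = 2 n + 2 = (4 n + 2) / 2 + 1` (`two_mul_finrank_eq`).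
-/

noncomputable section

namespace TimeDep

open Set Filter Topology Bundle

/-! ### Calculus on manifolds and their tangent bundles -/

section LocalCalculus

/-- The differential of a real function, as a covector: the manifold derivative, with values in
`ℝ` instead of the tangent spaces of `ℝ`. -/
def differential {E H N : Type*} [NormedAddCommGroup E] [NormedSpace ℝ E] [TopologicalSpace H]
    (I : ModelWithCorners ℝ E H) [TopologicalSpace N] [ChartedSpace H N] (f : N → ℝ) (x : N) :
    TangentSpace I x →L[ℝ] ℝ :=
  mfderiv I 𝓘(ℝ, ℝ) f x

variable {E H N F : Type*} [NormedAddCommGroup E] [NormedSpace ℝ E] [TopologicalSpace H]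
  {I : ModelWithCorners ℝ E H} [TopologicalSpace N] [ChartedSpace H N] [IsManifold I ∞ N]
  [I.Boundaryless] [NormedAddCommGroup F] [NormedSpace ℝ F]

omit [IsManifold I ∞ N] [I.Boundaryless] in
theorem extChartAt_source_mem_nhds_of_mem {x y : N} (hy : y ∈ (chartAt H x).source) :
    (extChartAt I x).source ∈ 𝓝 y :=
  extChartAt_source_mem_nhds' (by rwa [extChartAt_source])

theorem mdifferentiableAt_extChartAt_symm {x : N} {y : E} (hy : y ∈ (extChartAt I x).target) :
    MDifferentiableAt 𝓘(ℝ, E) I (extChartAt I x).symm y :=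
  ((contMDiffOn_extChartAt_symm (n := ∞) x).contMDiffAt
    ((isOpen_extChartAt_target x).mem_nhds hy)).mdifferentiableAt (by simp)

theorem contDiffAt_comp_extChartAt_symm {f : N → F} {x y : N} (hy : y ∈ (chartAt H x).source)
    (hf : ContMDiffAt I 𝓘(ℝ, F) ∞ f y) :
    ContDiffAt ℝ ∞ (f ∘ (extChartAt I x).symm) (extChartAt I x y) := by
  rw [← extChartAt_source I] at hy
  rw [← contMDiffAt_iff_contDiffAt]
  refine ContMDiffAt.comp _ ?_ ((contMDiffOn_extChartAt_symm (n := ∞) x).contMDiffAt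
    ((isOpen_extChartAt_target x).mem_nhds ((extChartAt I x).map_source hy)))
  rwa [(extChartAt I x).left_inv hy]

theorem mfderiv_comp_extChartAt_symm {f : N → F} {x : N} {y : E}
    (hy : y ∈ (extChartAt I x).target)
    (hf : MDifferentiableAt I 𝓘(ℝ, F) f ((extChartAt I x).symm y)) :
    (mfderiv I 𝓘(ℝ, F) f ((extChartAt I x).symm y)).comp
      (mfderiv 𝓘(ℝ, E) I (extChartAt I x).symm y) = fderiv ℝ (f ∘ (extChartAt I x).symm) y := by
  rw [← mfderiv_eq_fderiv]
  exact (mfderiv_comp y hf (mdifferentiableAt_extChartAt_symm hy)).symm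

theorem differentiableAt_comp_extChartAt_symm {f : N → F} {x y : N}
    (hy : y ∈ (chartAt H x).source) (hf : MDifferentiableAt I 𝓘(ℝ, F) f y) :
    DifferentiableAt ℝ (f ∘ (extChartAt I x).symm) (extChartAt I x y) := by
  rw [← extChartAt_source I] at hy
  rw [← mdifferentiableAt_iff_differentiableAt]
  refine MDifferentiableAt.comp _ ?_
    (mdifferentiableAt_extChartAt_symm ((extChartAt I x).map_source hy))
  rwa [(extChartAt I x).left_inv hy]

/-- A differential in terms of the chart at a nearby point. -/
theorem mfderiv_eq_fderiv_comp {f : N → F} {x y : N} (hy : y ∈ (chartAt H x).source)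
    (hf : MDifferentiableAt I 𝓘(ℝ, F) f y) :
    mfderiv I 𝓘(ℝ, F) f y = (fderiv ℝ (f ∘ (extChartAt I x).symm) (extChartAt I x y)).comp
      (mfderiv I 𝓘(ℝ, E) (extChartAt I x) y) := by
  have h1 : f =ᶠ[𝓝 y] (f ∘ (extChartAt I x).symm) ∘ extChartAt I x := by
    filter_upwards [extChartAt_source_mem_nhds_of_mem (I := I) hy] with y' hy'
    exact congrArg f ((extChartAt I x).left_inv hy').symm
  have h2 := (differentiableAt_comp_extChartAt_symm hy hf).hasFDerivAt.hasMFDerivAt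
  have h3 := (mdifferentiableAt_extChartAt (I := I) hy).hasMFDerivAt
  exact ((h2.comp y h3).congr_of_eventuallyEq h1).mfderiv

omit [I.Boundaryless] in
theorem eventually_mdifferentiableAt {f : N → F} {x : N} (hf : ContMDiffAt I 𝓘(ℝ, F) ∞ f x) :
    ∀ᶠ y in 𝓝 x, MDifferentiableAt I 𝓘(ℝ, F) f y := by
  have h1 : ContMDiffAt I 𝓘(ℝ, F) 1 f x := hf.of_le (by simp)
  filter_upwards [(contMDiffAt_iff_contMDiffAt_nhds (by simp)).1 h1] with y hy
  exact hy.mdifferentiableAt (by simp)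

omit [I.Boundaryless] in
theorem extChartAt_tangent_apply {z z' : TangentBundle I N} (hz : z'.1 ∈ (chartAt H z.1).source) :
    extChartAt I.tangent z z' =
      (extChartAt I z.1 z'.1, mfderiv I 𝓘(ℝ, E) (extChartAt I z.1) z'.1 z'.2) := by
  have hz' : z'.1 ∈ (trivializationAt E (TangentSpace I) z.1).baseSet := by
    rwa [TangentBundle.trivializationAt_baseSet]
  rw [← TangentBundle.continuousLinearMapAt_trivializationAt hz, FiberBundle.extChartAt]
  refine Prod.ext (by simp) ?_
  exact (congrFun (Trivialization.coe_linearMapAt_of_mem (R := ℝ) _ hz') z'.2).symm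

theorem dot_eq_fderiv {f : N → ℝ} {z z' : TangentBundle I N} (hz : z'.1 ∈ (chartAt H z.1).source)
    (hf : MDifferentiableAt I 𝓘(ℝ, ℝ) f z'.1) :
    dot I f z' = fderiv ℝ (f ∘ (extChartAt I z.1).symm) (extChartAt I.tangent z z').1
      (extChartAt I.tangent z z').2 := by
  rw [extChartAt_tangent_apply hz, dot, mfderiv_eq_fderiv_comp hz hf]
  rfl

omit [I.Boundaryless] in
theorem continuous_tangent_proj : Continuous (TotalSpace.proj : TangentBundle I N → N) :=
  (contMDiff_proj (n := ∞) (IB := I) (TangentSpace I : N → Type _)).continuous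

theorem eventually_dot_eq {f : N → ℝ} {z : TangentBundle I N}
    (hf : ContMDiffAt I 𝓘(ℝ, ℝ) ∞ f z.1) :
    dot I f =ᶠ[𝓝 z] (fun u : E × E => fderiv ℝ (f ∘ (extChartAt I z.1).symm) u.1 u.2) ∘
      extChartAt I.tangent z := by
  have h2 : ContinuousAt (TotalSpace.proj : TangentBundle I N → N) z :=
    continuous_tangent_proj.continuousAt
  filter_upwards [h2.eventually (eventually_mdifferentiableAt hf),
    h2.eventually (chart_source_mem_nhds H z.1)] with z' h3 h4
  exact dot_eq_fderiv h4 h3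

theorem contDiffAt_fderiv_apply {g : E → ℝ} {u : E × E} (hg : ContDiffAt ℝ ∞ g u.1) :
    ContDiffAt ℝ ∞ (fun u : E × E => fderiv ℝ g u.1 u.2) u :=
  ((hg.fderiv_right (m := ∞) (by simp)).comp u contDiffAt_fst).clm_apply contDiffAt_snd

theorem hasFDerivAt_fderiv_apply {g : E → ℝ} {u : E × E} (hg : ContDiffAt ℝ ∞ g u.1) :
    HasFDerivAt (fun u : E × E => fderiv ℝ g u.1 u.2)
      (((fderiv ℝ (fderiv ℝ g) u.1).comp (ContinuousLinearMap.fst ℝ E E)).flip u.2 +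
        (fderiv ℝ g u.1).comp (ContinuousLinearMap.snd ℝ E E)) u := by
  have h1 := ((hg.fderiv_right (m := ∞) (by simp)).differentiableAt (by simp)).hasFDerivAt
  have h2 := (h1.comp u hasFDerivAt_fst).clm_apply (hasFDerivAt_snd (p := u))
  refine h2.congr_fderiv (ContinuousLinearMap.ext fun w => ?_)
  simp [add_comm]

omit [I.Boundaryless] in
theorem extChartAt_tangent_self_fst (z : TangentBundle I N) :
    (extChartAt I.tangent z z).1 = extChartAt I z.1 z.1 :=
  congrArg Prod.fst (extChartAt_tangent_apply (mem_chart_source H z.1))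

theorem contDiffAt_comp_extChartAt_symm_tangent {f : N → F} {z : TangentBundle I N}
    (hf : ContMDiffAt I 𝓘(ℝ, F) ∞ f z.1) :
    ContDiffAt ℝ ∞ (f ∘ (extChartAt I z.1).symm) (extChartAt I.tangent z z).1 := by
  rw [extChartAt_tangent_self_fst]
  exact contDiffAt_comp_extChartAt_symm (mem_chart_source H z.1) hf

theorem contMDiffAt_dot {f : N → ℝ} {z : TangentBundle I N}
    (hf : ContMDiffAt I 𝓘(ℝ, ℝ) ∞ f z.1) : ContMDiffAt I.tangent 𝓘(ℝ, ℝ) ∞ (dot I f) z := by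
  refine ContMDiffAt.congr_of_eventuallyEq ?_ (eventually_dot_eq hf)
  exact (contDiffAt_fderiv_apply (contDiffAt_comp_extChartAt_symm_tangent hf)).contMDiffAt.comp z
    contMDiffAt_extChartAt

omit [I.Boundaryless] in
theorem hasMFDerivAt_extChartAt_tangent (z : TangentBundle I N) :
    HasMFDerivAt I.tangent 𝓘(ℝ, E × E) (extChartAt I.tangent z) z
      (mfderiv I.tangent 𝓘(ℝ, E × E) (extChartAt I.tangent z) z) :=
  (contMDiffAt_extChartAt (n := ∞)).mdifferentiableAt (by simp) |>.hasMFDerivAt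

/-- The differential of `ḟ`, in the coordinates of `TN` induced by a chart of `N`. -/
theorem mfderiv_dot {f : N → ℝ} {z : TangentBundle I N} (hf : ContMDiffAt I 𝓘(ℝ, ℝ) ∞ f z.1)
    (w : TangentSpace I.tangent z) :
    differential I.tangent (dot I f) z w =
      fderiv ℝ (fderiv ℝ (f ∘ (extChartAt I z.1).symm)) (extChartAt I.tangent z z).1
          (mfderiv I.tangent 𝓘(ℝ, E × E) (extChartAt I.tangent z) z w).1
          (extChartAt I.tangent z z).2 +
        fderiv ℝ (f ∘ (extChartAt I z.1).symm) (extChartAt I.tangent z z).1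
          (mfderiv I.tangent 𝓘(ℝ, E × E) (extChartAt I.tangent z) z w).2 := by
  have h1 := (hasFDerivAt_fderiv_apply (contDiffAt_comp_extChartAt_symm_tangent hf)).hasMFDerivAt
  have h2 := ((h1.comp z (hasMFDerivAt_extChartAt_tangent z)).congr_of_eventuallyEq
    (eventually_dot_eq hf)).mfderiv
  exact DFunLike.congr_fun h2 w

/-- The differential of the pull-back to `TN` of a function on `N`. -/
theorem mfderiv_comp_proj {f : N → ℝ} {z : TangentBundle I N} (hf : ContMDiffAt I 𝓘(ℝ, ℝ) ∞ f z.1)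
    (w : TangentSpace I.tangent z) :
    differential I.tangent (fun z' : TangentBundle I N => f z'.1) z w =
      fderiv ℝ (f ∘ (extChartAt I z.1).symm) (extChartAt I.tangent z z).1
        (mfderiv I.tangent 𝓘(ℝ, E × E) (extChartAt I.tangent z) z w).1 := by
  have h1 := (((contDiffAt_comp_extChartAt_symm_tangent hf).differentiableAt
    (by simp)).hasFDerivAt.comp _ hasFDerivAt_fst).hasMFDerivAt
  have h3 : (fun z' : TangentBundle I N => f z'.1) =ᶠ[𝓝 z]
      ((f ∘ (extChartAt I z.1).symm) ∘ Prod.fst) ∘ extChartAt I.tangent z := by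
    filter_upwards [continuous_tangent_proj.continuousAt.eventually
      (chart_source_mem_nhds H z.1)] with z' h4
    rw [Function.comp_apply, extChartAt_tangent_apply h4]
    exact congrArg f ((extChartAt I z.1).left_inv (by rwa [extChartAt_source])).symm
  have h2 := ((h1.comp z (hasMFDerivAt_extChartAt_tangent z)).congr_of_eventuallyEq h3).mfderiv
  exact DFunLike.congr_fun h2 w

/-- If the differentials of the functions `fᵢ` are independent, then so are those of the functions
`fᵢ`, `ḟᵢ` on the tangent bundle. -/
theorem dot_family_surjective {ι : Type*} {f : ι → N → ℝ} {z : TangentBundle I N}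
    (hf : ∀ i, ContMDiffAt I 𝓘(ℝ, ℝ) ∞ (f i) z.1)
    (hs : ∀ a : ι → ℝ, ∃ v : TangentSpace I z.1, ∀ i, differential I (f i) z.1 v = a i)
    (a b : ι → ℝ) : ∃ w : TangentSpace I.tangent z, ∀ i,
      differential I.tangent (fun z' : TangentBundle I N => f i z'.1) z w = a i ∧
      differential I.tangent (dot I (f i)) z w = b i := by
  have hs' : ∀ a : ι → ℝ, ∃ u : E, ∀ i,
      fderiv ℝ (f i ∘ (extChartAt I z.1).symm) (extChartAt I.tangent z z).1 u = a i := by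
    intro a
    obtain ⟨v, hv⟩ := hs a
    refine ⟨mfderiv I 𝓘(ℝ, E) (extChartAt I z.1) z.1 v, fun i => ?_⟩
    rw [← hv i, differential, extChartAt_tangent_self_fst,
      mfderiv_eq_fderiv_comp (mem_chart_source H z.1) ((hf i).mdifferentiableAt (by simp))]
    rfl
  obtain ⟨u, hu⟩ := hs' a
  obtain ⟨u', hu'⟩ := hs' fun i => b i -
    fderiv ℝ (fderiv ℝ (f i ∘ (extChartAt I z.1).symm)) (extChartAt I.tangent z z).1 u
      (extChartAt I.tangent z z).2
  obtain ⟨w, hw⟩ := (isInvertible_mfderiv_extChartAt (I := I.tangent)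
    (mem_extChartAt_source z)).surjective ((u, u') : E × E)
  refine ⟨w, fun i => ⟨?_, ?_⟩⟩
  · rw [mfderiv_comp_proj (hf i), hw]
    exact hu i
  · rw [mfderiv_dot (hf i), hw]
    exact (congrArg _ (hu' i)).trans (add_sub_cancel _ _)

end LocalCalculus

section Differentials

variable {E H N : Type*} [NormedAddCommGroup E] [NormedSpace ℝ E] [TopologicalSpace H]
  {I : ModelWithCorners ℝ E H} [TopologicalSpace N] [ChartedSpace H N]

theorem differential_apply_pi {κ : Type*} [Fintype κ] {f : N → κ → ℝ} {z : N}
    (hf : MDifferentiableAt I 𝓘(ℝ, κ → ℝ) f z) (w : TangentSpace I z) (i : κ) :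
    differential I (fun z => f z i) z w = mfderiv I 𝓘(ℝ, κ → ℝ) f z w i :=
  DFunLike.congr_fun (((ContinuousLinearMap.proj (R := ℝ) (φ := fun _ : κ => ℝ)
    i).hasMFDerivAt).comp z hf.hasMFDerivAt).mfderiv w

theorem differential_comp_proj [IsManifold I ∞ N] {f : N → ℝ} {z : TangentBundle I N}
    (hf : MDifferentiableAt I 𝓘(ℝ, ℝ) f z.1) (w : TangentSpace I.tangent z) :
    differential I.tangent (fun z' : TangentBundle I N => f z'.1) z w =
      differential I f z.1 (mfderiv I.tangent I (TotalSpace.proj : TangentBundle I N → N) z w) := by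
  have hp : ContMDiffAt I.tangent I ∞ (TotalSpace.proj : TangentBundle I N → N) z :=
    contMDiffAt_proj (TangentSpace I : N → Type _)
  exact DFunLike.congr_fun (hf.hasMFDerivAt.comp z
    (hp.mdifferentiableAt (by simp)).hasMFDerivAt).mfderiv w

theorem differential_congr_add {f g F : N → ℝ} {z : N} (hf : MDifferentiableAt I 𝓘(ℝ, ℝ) f z)
    (hg : MDifferentiableAt I 𝓘(ℝ, ℝ) g z) (hF : ∀ᶠ z' in 𝓝 z, F z' = f z' + g z')
    (w : TangentSpace I z) :
    differential I F z w = differential I f z w + differential I g z w :=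
  DFunLike.congr_fun ((hf.hasMFDerivAt.add hg.hasMFDerivAt).congr_of_eventuallyEq hF).mfderiv w

/-- The differentials of the functions `qⱼ`, `pⱼ`, `q̇ⱼ`, `ṗⱼ` on the tangent bundle are independent
if those of `qⱼ`, `pⱼ` are. -/
theorem exists_tangent_dot [IsManifold I ∞ N] [I.Boundaryless] {ι : Type*} {q p : ι → N → ℝ}
    {z : TangentBundle I N} (hq : ∀ i, ContMDiffAt I 𝓘(ℝ, ℝ) ∞ (q i) z.1)
    (hp : ∀ i, ContMDiffAt I 𝓘(ℝ, ℝ) ∞ (p i) z.1)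
    (hs : ∀ a : ι ⊕ ι → ℝ, ∃ v : TangentSpace I z.1, ∀ i,
      differential I (Sum.elim q p i) z.1 v = a i) (a b c d : ι → ℝ) :
    ∃ w : TangentSpace I.tangent z,
      (∀ j, differential I.tangent (fun z' : TangentBundle I N => q j z'.1) z w = a j) ∧
      (∀ j, differential I.tangent (fun z' : TangentBundle I N => p j z'.1) z w = b j) ∧
      (∀ j, differential I.tangent (dot I (q j)) z w = c j) ∧
      ∀ j, differential I.tangent (dot I (p j)) z w = d j := by
  obtain ⟨w, hw⟩ := dot_family_surjective (Sum.forall.2 ⟨hq, hp⟩) hs (Sum.elim a b) (Sum.elim c d)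
  exact ⟨w, fun j => (hw (.inl j)).1, fun j => (hw (.inr j)).1, fun j => (hw (.inl j)).2,
    fun j => (hw (.inr j)).2⟩

theorem hasDerivAt_comp_velocity {f : N → ℝ} {γ : ℝ → N} {t : ℝ}
    (hf : MDifferentiableAt I 𝓘(ℝ, ℝ) f (γ t)) (hγ : MDifferentiableAt 𝓘(ℝ, ℝ) I γ t) :
    HasDerivAt (fun s => f (γ s)) (dot I f (velocity γ t)) t := by
  let L : ℝ →L[ℝ] ℝ := (mfderiv I 𝓘(ℝ, ℝ) f (γ t)).comp (mfderiv 𝓘(ℝ, ℝ) I γ t)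
  have h1 : HasFDerivAt (fun s => f (γ s)) L t :=
    hasMFDerivAt_iff_hasFDerivAt.1 (hf.hasMFDerivAt.comp t hγ.hasMFDerivAt)
  exact h1.hasDerivAt

end Differentials

/-! ### Exterior derivatives and complete lifts in terms of functions -/

section Forms

variable {E H N ι : Type*} [NormedAddCommGroup E] [NormedSpace ℝ E] [TopologicalSpace H]
  {I : ModelWithCorners ℝ E H} [TopologicalSpace N] [ChartedSpace H N] [IsManifold I ∞ N]
  [I.Boundaryless] [Fintype ι]

/-- The differential of `f` on the image of a vector under the inverse of a chart. -/
theorem eventually_differential_comp_symm {f : N → ℝ} {x : N}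
    (hf : ContMDiffAt I 𝓘(ℝ, ℝ) ∞ f x) :
    ∀ᶠ y in 𝓝 (extChartAt I x x), ∀ u : E, differential I f ((extChartAt I x).symm y)
      (mfderiv 𝓘(ℝ, E) I (extChartAt I x).symm y u) =
        fderiv ℝ (f ∘ (extChartAt I x).symm) y u := by
  have h1 : Tendsto (extChartAt I x).symm (𝓝 (extChartAt I x x)) (𝓝 x) := by
    have := (continuousAt_extChartAt_symm (I := I) x).tendsto
    rwa [extChartAt_to_inv] at this
  filter_upwards [h1.eventually (eventually_mdifferentiableAt hf),
    extChartAt_target_mem_nhds (I := I) x] with y h2 h3 u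
  exact DFunLike.congr_fun (mfderiv_comp_extChartAt_symm h3 h2) u

theorem differential_eq_fderiv {f : N → ℝ} {x : N} (hf : ContMDiffAt I 𝓘(ℝ, ℝ) ∞ f x)
    (u : TangentSpace I x) :
    differential I f x u = fderiv ℝ (f ∘ (extChartAt I x).symm) (extChartAt I x x)
      (mfderiv I 𝓘(ℝ, E) (extChartAt I x) x u) := by
  rw [differential, mfderiv_eq_fderiv_comp (mem_chart_source H x) (hf.mdifferentiableAt (by simp))]
  rfl

/-- The exterior derivative of `∑ fⱼ dgⱼ` is `∑ dfⱼ ∧ dgⱼ`: the second derivatives of the `gⱼ` in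
a chart are symmetric. -/
theorem extDerivOne_eq_sum {θ : ∀ x : N, TangentSpace I x →L[ℝ] ℝ} {x : N} {f g : ι → N → ℝ}
    (hf : ∀ j, ContMDiffAt I 𝓘(ℝ, ℝ) ∞ (f j) x) (hg : ∀ j, ContMDiffAt I 𝓘(ℝ, ℝ) ∞ (g j) x)
    (hθ : ∀ᶠ y in 𝓝 x, ∀ v : TangentSpace I y, θ y v = ∑ j, f j y * differential I (g j) y v)
    (v w : TangentSpace I x) :
    extDerivOne θ x v w = ∑ j, (differential I (f j) x v * differential I (g j) x w -
      differential I (f j) x w * differential I (g j) x v) := by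
  let e := extChartAt I x
  have h1 : Tendsto e.symm (𝓝 (e x)) (𝓝 x) := by
    have := (continuousAt_extChartAt_symm (I := I) x).tendsto
    rwa [extChartAt_to_inv] at this
  have h2 : (fun y => (θ (e.symm y)).comp (mfderiv 𝓘(ℝ, E) I e.symm y)) =ᶠ[𝓝 (e x)]
      fun y => ∑ j, (f j ∘ e.symm) y • fderiv ℝ (g j ∘ e.symm) y := by
    filter_upwards [h1.eventually hθ, eventually_all.2 fun j =>
      eventually_differential_comp_symm (hg j)] with y h3 h4
    refine ContinuousLinearMap.ext fun u => (h3 _).trans ?_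
    rw [sum_apply]
    exact Finset.sum_congr rfl fun j _ => congrArg _ (h4 j u)
  have hfe (j) : ContDiffAt ℝ ∞ (f j ∘ e.symm) (e x) :=
    contDiffAt_comp_extChartAt_symm (mem_chart_source H x) (hf j)
  have hge (j) : ContDiffAt ℝ ∞ (g j ∘ e.symm) (e x) :=
    contDiffAt_comp_extChartAt_symm (mem_chart_source H x) (hg j)
  have h5 : HasFDerivAt (fun y => ∑ j, (f j ∘ e.symm) y • fderiv ℝ (g j ∘ e.symm) y) _ (e x) :=
    HasFDerivAt.fun_sum fun j _ => (((hfe j).differentiableAt (by simp)).hasFDerivAt).smul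
      ((((hge j).fderiv_right (m := ∞) (by simp)).differentiableAt (by simp)).hasFDerivAt)
  have h7 : extDerivOne θ x v w =
      fderiv ℝ (fun y => ∑ j, (f j ∘ e.symm) y • fderiv ℝ (g j ∘ e.symm) y) (e x)
        (mfderiv I 𝓘(ℝ, E) e x v) (mfderiv I 𝓘(ℝ, E) e x w) -
      fderiv ℝ (fun y => ∑ j, (f j ∘ e.symm) y • fderiv ℝ (g j ∘ e.symm) y) (e x)
        (mfderiv I 𝓘(ℝ, E) e x w) (mfderiv I 𝓘(ℝ, E) e x v) := by
    rw [← h2.fderiv_eq]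
    rfl
  rw [h7, h5.fderiv]
  simp only [differential_eq_fderiv (hf _), differential_eq_fderiv (hg _)]
  change _ = ∑ j, (fderiv ℝ (f j ∘ e.symm) (e x) (mfderiv I 𝓘(ℝ, E) e x v) *
    fderiv ℝ (g j ∘ e.symm) (e x) (mfderiv I 𝓘(ℝ, E) e x w) -
    fderiv ℝ (f j ∘ e.symm) (e x) (mfderiv I 𝓘(ℝ, E) e x w) *
    fderiv ℝ (g j ∘ e.symm) (e x) (mfderiv I 𝓘(ℝ, E) e x v))
  generalize mfderiv I 𝓘(ℝ, E) e x v = v'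
  generalize mfderiv I 𝓘(ℝ, E) e x w = w'
  change E at v' w'
  simp only [sum_apply, ← Finset.sum_sub_distrib]
  refine Finset.sum_congr rfl fun j _ => ?_
  have h8 : fderiv ℝ (fderiv ℝ (g j ∘ e.symm)) (e x) v' w' =
      fderiv ℝ (fderiv ℝ (g j ∘ e.symm)) (e x) w' v' :=
    ((hge j).isSymmSndFDerivAt (by
      rw [minSmoothness_of_isRCLikeNormedField]
      exact ENat.LEInfty.out)) v' w'
  simp only [add_apply, smul_apply, smul_eq_mul, ContinuousLinearMap.smulRight_apply, h8]
  ring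

set_option synthInstance.maxHeartbeats 200000 in
theorem differentiableAt_wedge {f g : ι → E → ℝ} {x : E} (hf : ∀ j, ContDiffAt ℝ ∞ (f j) x)
    (hg : ∀ j, ContDiffAt ℝ ∞ (g j) x) :
    DifferentiableAt ℝ (fun x => ∑ j, ((fderiv ℝ (f j) x).smulRight (fderiv ℝ (g j) x) -
      (fderiv ℝ (g j) x).smulRight (fderiv ℝ (f j) x))) x := by
  have hs {k l : E → ℝ} (hk : ContDiffAt ℝ ∞ k x) (hl : ContDiffAt ℝ ∞ l x) :
      DifferentiableAt ℝ (fun y => (fderiv ℝ k y).smulRight (fderiv ℝ l y)) x :=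
    ((hk.fderiv_right (m := ∞) (by simp)).smulRight
      (hl.fderiv_right (m := ∞) (by simp))).differentiableAt (by simp)
  refine DifferentiableAt.fun_sum (𝕜 := ℝ) (E := E) (F := E →L[ℝ] E →L[ℝ] ℝ)
    (A := fun j x => (fderiv ℝ (f j) x).smulRight (fderiv ℝ (g j) x) -
      (fderiv ℝ (g j) x).smulRight (fderiv ℝ (f j) x)) fun j _ => ?_
  exact (hs (hf j) (hg j)).sub (hs (hg j) (hf j))

theorem fderiv_bilinear_apply {B : E → E →L[ℝ] E →L[ℝ] ℝ} {x : E} (hB : DifferentiableAt ℝ B x)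
    (y a b : E) : fderiv ℝ B x y a b = fderiv ℝ (fun x => B x a b) x y := by
  have h1 : HasFDerivAt (fun x => B x a) ((fderiv ℝ B x).flip a) x := by
    simpa using hB.hasFDerivAt.clm_apply (hasFDerivAt_const a x)
  have h2 : HasFDerivAt (fun x => B x a b) (((fderiv ℝ B x).flip a).flip b) x := by
    simpa using h1.clm_apply (hasFDerivAt_const b x)
  rw [h2.fderiv]
  rfl

/-- The derivative in the direction `y` of the 2-form `∑ dfⱼ ∧ dgⱼ` on a normed space. -/
theorem fderiv_wedge_apply {f g : ι → E → ℝ} {x : E} (hf : ∀ j, ContDiffAt ℝ ∞ (f j) x)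
    (hg : ∀ j, ContDiffAt ℝ ∞ (g j) x) (y a b : E) :
    fderiv ℝ (fun x => ∑ j, ((fderiv ℝ (f j) x).smulRight (fderiv ℝ (g j) x) -
      (fderiv ℝ (g j) x).smulRight (fderiv ℝ (f j) x))) x y a b = ∑ j,
      ((fderiv ℝ (fderiv ℝ (f j)) x y a * fderiv ℝ (g j) x b +
        fderiv ℝ (f j) x a * fderiv ℝ (fderiv ℝ (g j)) x y b) -
      (fderiv ℝ (fderiv ℝ (g j)) x y a * fderiv ℝ (f j) x b +
        fderiv ℝ (g j) x a * fderiv ℝ (fderiv ℝ (f j)) x y b)) := by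
  rw [fderiv_bilinear_apply (differentiableAt_wedge hf hg)]
  have hd {k : E → ℝ} (hk : ContDiffAt ℝ ∞ k x) (a : E) :
      HasFDerivAt (fun x => fderiv ℝ k x a) ((fderiv ℝ (fderiv ℝ k) x).flip a) x := by
    simpa using ((hk.fderiv_right (m := ∞) (by simp)).differentiableAt
      (by simp)).hasFDerivAt.clm_apply (hasFDerivAt_const a x)
  have h := HasFDerivAt.fun_sum (u := Finset.univ) fun j _ =>
    ((hd (hf j) a).fun_mul (hd (hg j) b)).fun_sub ((hd (hg j) a).fun_mul (hd (hf j) b))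
  simp only [sum_apply, sub_apply, ContinuousLinearMap.smulRight_apply, smul_apply, smul_eq_mul]
  rw [h.fderiv, sum_apply]
  refine Finset.sum_congr rfl fun j _ => ?_
  simp only [sub_apply, add_apply, smul_apply, ContinuousLinearMap.flip_apply, smul_eq_mul]
  ring

/-- The complete lift of `∑ dfⱼ ∧ dgⱼ` is `∑ (dḟⱼ ∧ dgⱼ + dfⱼ ∧ dġⱼ)`. -/
theorem completeLift_eq_sum {B : ∀ x : N, TangentSpace I x →L[ℝ] TangentSpace I x →L[ℝ] ℝ}
    {z : TangentBundle I N} {f g : ι → N → ℝ}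
    (hf : ∀ j, ContMDiffAt I 𝓘(ℝ, ℝ) ∞ (f j) z.1) (hg : ∀ j, ContMDiffAt I 𝓘(ℝ, ℝ) ∞ (g j) z.1)
    (hB : ∀ᶠ y in 𝓝 z.1, ∀ v w : TangentSpace I y, B y v w =
      ∑ j, (differential I (f j) y v * differential I (g j) y w -
        differential I (f j) y w * differential I (g j) y v)) (v w : TangentSpace I.tangent z) :
    completeLift B z v w = ∑ j,
      (differential I.tangent (dot I (f j)) z v *
          differential I.tangent (fun z' : TangentBundle I N => g j z'.1) z w -
        differential I.tangent (dot I (f j)) z w *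
          differential I.tangent (fun z' : TangentBundle I N => g j z'.1) z v +
        (differential I.tangent (fun z' : TangentBundle I N => f j z'.1) z v *
          differential I.tangent (dot I (g j)) z w -
        differential I.tangent (fun z' : TangentBundle I N => f j z'.1) z w *
          differential I.tangent (dot I (g j)) z v)) := by
  let e := extChartAt I z.1
  let x : E := (extChartAt I.tangent z z).1
  have hxe : x = e z.1 := extChartAt_tangent_self_fst z
  have h1 : Tendsto e.symm (𝓝 (e z.1)) (𝓝 z.1) := by
    have := (continuousAt_extChartAt_symm (I := I) z.1).tendsto
    rwa [extChartAt_to_inv] at this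
  let Be : E → E →L[ℝ] E →L[ℝ] ℝ := fun y => ∑ j,
    ((fderiv ℝ (f j ∘ e.symm) y).smulRight (fderiv ℝ (g j ∘ e.symm) y) -
      (fderiv ℝ (g j ∘ e.symm) y).smulRight (fderiv ℝ (f j ∘ e.symm) y))
  have h2 : (fun y => pull (mfderiv 𝓘(ℝ, E) I e.symm y) (mfderiv 𝓘(ℝ, E) I e.symm y)
      (B (e.symm y))) =ᶠ[𝓝 x] Be := by
    rw [hxe]
    filter_upwards [h1.eventually hB, eventually_all.2 fun j =>
      eventually_differential_comp_symm (hg j), eventually_all.2 fun j =>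
      eventually_differential_comp_symm (hf j)] with y h3 h4 h5
    refine ContinuousLinearMap.ext fun u => ContinuousLinearMap.ext fun u' => (h3 _ _).trans ?_
    simp only [Be, sum_apply, sub_apply,
      ContinuousLinearMap.smulRight_apply, smul_apply, smul_eq_mul]
    refine Finset.sum_congr rfl fun j _ => ?_
    change _ = fderiv ℝ (f j ∘ (extChartAt I z.1).symm) y u *
      fderiv ℝ (g j ∘ (extChartAt I z.1).symm) y u' -
      fderiv ℝ (g j ∘ (extChartAt I z.1).symm) y u *
      fderiv ℝ (f j ∘ (extChartAt I z.1).symm) y u'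
    rw [← h4 j u, ← h4 j u', ← h5 j u, ← h5 j u', mul_comm (differential I (g j) _ _)]
    rfl
  have hfe (j) : ContDiffAt ℝ ∞ (f j ∘ e.symm) x := contDiffAt_comp_extChartAt_symm_tangent (hf j)
  have hge (j) : ContDiffAt ℝ ∞ (g j ∘ e.symm) x := contDiffAt_comp_extChartAt_symm_tangent (hg j)
  let T : TangentSpace I.tangent z →L[ℝ] E × E :=
    mfderiv I.tangent 𝓘(ℝ, E × E) (extChartAt I.tangent z) z
  let y : E := (extChartAt I.tangent z z).2
  have h4 : completeLift B z v w = fderiv ℝ Be x y (T v).1 (T w).1 + Be x (T v).2 (T w).1 +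
      Be x (T v).1 (T w).2 := by
    rw [← h2.fderiv_eq, ← h2.eq_of_nhds]
    rfl
  have h3 (a b : E) := fderiv_wedge_apply hfe hge y a b
  rw [h4, h3]
  have h5 {k : N → ℝ} (hk : ContMDiffAt I 𝓘(ℝ, ℝ) ∞ k z.1) (u : TangentSpace I.tangent z) :
      differential I.tangent (dot I k) z u =
        fderiv ℝ (fderiv ℝ (k ∘ e.symm)) x (T u).1 y + fderiv ℝ (k ∘ e.symm) x (T u).2 :=
    mfderiv_dot hk u
  have h6 {k : N → ℝ} (hk : ContMDiffAt I 𝓘(ℝ, ℝ) ∞ k z.1) (u : TangentSpace I.tangent z) :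
      differential I.tangent (fun z' : TangentBundle I N => k z'.1) z u =
        fderiv ℝ (k ∘ e.symm) x (T u).1 := mfderiv_comp_proj hk u
  simp only [h5 (hf _), h5 (hg _), h6 (hf _), h6 (hg _)]
  simp only [Be, sum_apply, sub_apply, ← Finset.sum_add_distrib,
    ContinuousLinearMap.smulRight_apply, smul_apply, smul_eq_mul]
  refine Finset.sum_congr rfl fun j _ => ?_
  have h8 {k : E → ℝ} (hk : ContDiffAt ℝ ∞ k x) (v' w' : E) :
      fderiv ℝ (fderiv ℝ k) x v' w' = fderiv ℝ (fderiv ℝ k) x w' v' :=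
    (hk.isSymmSndFDerivAt (by
      rw [minSmoothness_of_isRCLikeNormedField]
      exact ENat.LEInfty.out)) v' w'
  rw [h8 (hfe j) y, h8 (hfe j) y, h8 (hge j) y, h8 (hge j) y]
  ring

end Forms

/-! ### Tangent spaces of submanifolds given by equations -/

section LevelSets

/-- A vector `w` in the kernel of a surjective derivative is the velocity of a curve in the level
set: by the inverse function theorem applied to `(r, g) ↦ (r, f (x + r w + R g))`, where `R` is a
right inverse of the derivative. -/
theorem exists_curve_in_level {E G : Type*} [NormedAddCommGroup E] [NormedSpace ℝ E]
    [NormedAddCommGroup G] [NormedSpace ℝ G] [FiniteDimensional ℝ G] {f : E → G} {x w : E}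
    (hf : ContDiffAt ℝ ∞ f x) (hs : Function.Surjective (fderiv ℝ f x))
    (hw : fderiv ℝ f x w = 0) :
    ∃ γ : ℝ → E, ContDiffAt ℝ ∞ γ 0 ∧ γ 0 = x ∧ HasDerivAt γ w 0 ∧ ∀ᶠ r in 𝓝 0, f (γ r) = f x := by
  obtain ⟨R₀, hR₀⟩ := (fderiv ℝ f x).toLinearMap.exists_rightInverse_of_surjective
    (LinearMap.range_eq_top.2 hs)
  let R : G →L[ℝ] E := LinearMap.toContinuousLinearMap R₀
  have hR (g : G) : fderiv ℝ f x (R g) = g := LinearMap.congr_fun hR₀ g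
  -- By the choice of `R`, and as `f' w = 0`, the derivative at `0` of the map `ψ` below
  -- is the identity.
  let A : ℝ × G →L[ℝ] E := (ContinuousLinearMap.fst ℝ ℝ G).smulRight w +
    R.comp (ContinuousLinearMap.snd ℝ ℝ G)
  have hA (u : ℝ × G) : A u = u.1 • w + R u.2 := rfl
  let ψ : ℝ × G → ℝ × G := fun u => (u.1, f (x + A u))
  have hx : x + A 0 = x := by simp
  have hc : ContDiffAt ℝ ∞ ψ 0 := by
    refine contDiffAt_fst.prodMk (ContDiffAt.comp 0 ?_ (contDiffAt_const.add A.contDiff.contDiffAt))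
    rwa [hx]
  have hd : HasFDerivAt ψ ((ContinuousLinearEquiv.refl ℝ (ℝ × G) : ℝ × G →L[ℝ] ℝ × G)) 0 := by
    have h1 : HasFDerivAt f (fderiv ℝ f x) (x + A 0) := by
      rw [hx]; exact (hf.differentiableAt (by simp)).hasFDerivAt
    have h2 := hasFDerivAt_fst.prodMk (h1.comp (0 : ℝ × G) (A.hasFDerivAt.const_add x))
    refine h2.congr_fderiv (ContinuousLinearMap.ext fun u => ?_)
    refine Prod.ext rfl ?_
    simp [hA, hw, hR]
  have hψ0 : ψ 0 = (0, f x) := by simp [ψ]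
  let l := hc.localInverse hd (by simp)
  have hl : ContDiffAt ℝ ∞ l (0, f x) := hψ0 ▸ hc.to_localInverse hd (by simp)
  have hs' := hc.hasStrictFDerivAt' hd (by simp)
  have hl0 : l (0, f x) = 0 := by
    rw [← hψ0]; exact hs'.localInverse_apply_image
  have hld : HasFDerivAt l (ContinuousLinearMap.id ℝ (ℝ × G)) (0, f x) := by
    have h := hs'.to_localInverse.hasFDerivAt
    rw [hψ0] at h
    exact h
  have hli : ∀ᶠ u in 𝓝 ((0 : ℝ), f x), ψ (l u) = u := hψ0 ▸ hs'.eventually_right_inverse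
  have hk : HasDerivAt (fun r : ℝ => (r, f x)) (1, 0) 0 :=
    (hasDerivAt_id (0 : ℝ)).prodMk (hasDerivAt_const (0 : ℝ) (f x))
  refine ⟨fun r => x + A (l (r, f x)), ?_, ?_, ?_, ?_⟩
  · refine contDiffAt_const.add (A.contDiff.contDiffAt.comp 0 (ContDiffAt.comp 0 hl ?_))
    exact contDiffAt_id.prodMk contDiffAt_const
  · simp [hl0]
  · have h := (A.hasFDerivAt.comp_hasDerivAt (0 : ℝ)
      (hld.comp_hasDerivAt (0 : ℝ) hk)).const_add x
    simpa [hA] using h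
  · filter_upwards [hk.continuousAt.eventually hli] with r hr
    exact congrArg Prod.snd hr

variable {E H N F : Type*} [NormedAddCommGroup E] [NormedSpace ℝ E] [TopologicalSpace H]
  {I : ModelWithCorners ℝ E H} [TopologicalSpace N] [ChartedSpace H N] [IsManifold I ∞ N]
  [I.Boundaryless] [NormedAddCommGroup F] [NormedSpace ℝ F]

theorem hasMFDerivAt_extChartAt_symm_self (z : N) :
    HasMFDerivAt 𝓘(ℝ, E) I (extChartAt I z).symm (extChartAt I z z)
      (ContinuousLinearMap.id ℝ E) := by
  have h := (mdifferentiableAt_extChartAt_symm (I := I) (mem_extChartAt_target z)).hasMFDerivAt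
  have h1 := mfderivWithin_range_extChartAt_symm (I := I) (x := z)
  rw [I.range_eq_univ, mfderivWithin_univ] at h1
  rw [h1] at h
  exact h

theorem exists_curve_of_mem_ker [FiniteDimensional ℝ F] {f : N → F} {z : N}
    (hf : ContMDiffAt I 𝓘(ℝ, F) ∞ f z) (hs : Function.Surjective (mfderiv I 𝓘(ℝ, F) f z))
    {w : TangentSpace I z} (hw : mfderiv I 𝓘(ℝ, F) f z w = 0) :
    ∃ c : ℝ → N, ContMDiffAt 𝓘(ℝ, ℝ) I ∞ c 0 ∧ (∀ᶠ r in 𝓝 0, f (c r) = f z) ∧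
      velocity c 0 = (⟨z, w⟩ : TangentBundle I N) := by
  have hfe := contDiffAt_comp_extChartAt_symm (mem_chart_source H z) hf
  have hd : (mfderiv I 𝓘(ℝ, F) f z : E →L[ℝ] F) =
      fderiv ℝ (f ∘ (extChartAt I z).symm) (extChartAt I z z) := by
    rw [mfderiv_eq_fderiv_comp (mem_chart_source H z) (hf.mdifferentiableAt (by simp)),
      mfderiv_extChartAt_self]
    rfl
  have hs' : Function.Surjective
      (fderiv ℝ (f ∘ (extChartAt I z).symm) (extChartAt I z z)) := by
    rw [← hd]; exact hs
  have hw' : fderiv ℝ (f ∘ (extChartAt I z).symm) (extChartAt I z z) (show E from w) = 0 :=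
    (DFunLike.congr_fun hd (show E from w)).symm.trans hw
  obtain ⟨γ, hγ, hγ0, hγd, hγf⟩ := exists_curve_in_level hfe hs' hw'
  have h0 : (extChartAt I z).symm (γ 0) = z := by rw [hγ0, extChartAt_to_inv]
  refine ⟨(extChartAt I z).symm ∘ γ, ?_, ?_, ?_⟩
  · refine ContMDiffAt.comp 0 ?_ hγ.contMDiffAt
    rw [hγ0]
    exact (contMDiffOn_extChartAt_symm (n := ∞) z).contMDiffAt (extChartAt_target_mem_nhds z)
  · filter_upwards [hγf] with r hr
    exact hr.trans (congrArg f (extChartAt_to_inv z))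
  · have h1 : HasMFDerivAt 𝓘(ℝ, E) I (extChartAt I z).symm (γ 0) (ContinuousLinearMap.id ℝ E) := by
      rw [hγ0]; exact hasMFDerivAt_extChartAt_symm_self z
    have h2 := (h1.comp (0 : ℝ) hγd.hasFDerivAt.hasMFDerivAt).mfderiv
    refine TotalSpace.ext h0 (heq_of_eq ?_)
    change mfderiv 𝓘(ℝ, ℝ) I ((extChartAt I z).symm ∘ γ) 0 (1 : ℝ) = w
    rw [h2]
    change ((1 : ℝ) • (w : E) : E) = w
    exact one_smul ℝ (w : E)

omit [IsManifold I ∞ N] [I.Boundaryless] in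
theorem mfderiv_eq_zero_of_curve {f : N → F} {z : N} {w : TangentSpace I z}
    (hf : MDifferentiableAt I 𝓘(ℝ, F) f z) {c : ℝ → N} (hc : ContMDiffAt 𝓘(ℝ, ℝ) I ∞ c 0)
    (hv : velocity c 0 = (⟨z, w⟩ : TangentBundle I N)) {a : F} (ha : ∀ᶠ r in 𝓝 0, f (c r) = a) :
    mfderiv I 𝓘(ℝ, F) f z w = 0 := by
  obtain rfl : c 0 = z := congrArg TotalSpace.proj hv
  obtain rfl : mfderiv 𝓘(ℝ, ℝ) I c 0 (1 : ℝ) = w := by simpa [velocity] using hv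
  have h1 := (hf.hasMFDerivAt.comp (0 : ℝ) (hc.mdifferentiableAt (by simp)).hasMFDerivAt).mfderiv
  have h2 : f ∘ c =ᶠ[𝓝 0] fun _ => a := ha
  rw [h2.mfderiv_eq, mfderiv_const] at h1
  exact (DFunLike.congr_fun h1 (1 : ℝ)).symm

/-- The tangent space of a submanifold given by independent equations on a regular level set: one
inclusion is the chain rule, the other is `exists_curve_of_mem_ker`. -/
theorem DefiningEquations.curveTangent_eq {κ : Type} [Fintype κ] {g : N → ℝ} {S U : Set N}
    {f : N → κ → ℝ} (h : DefiningEquations I g S U f) {z : N} (hz : z ∈ S ∩ U)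
    (hg : ContMDiffAt I 𝓘(ℝ, ℝ) ∞ g z) (hd : ∃ w, differential I g z w = 1) :
    curveTangent I S z = levelTangent I g z ⊓
      LinearMap.ker (mfderiv I 𝓘(ℝ, κ → ℝ) f z).toLinearMap := by
  have hf : ContMDiffAt I 𝓘(ℝ, κ → ℝ) ∞ f z := h.smooth.contMDiffAt (h.isOpen.mem_nhds hz.2)
  apply le_antisymm
  · refine Submodule.span_le.2 ?_
    rintro w ⟨c, hc, hcS, hv⟩
    have hc0 : c 0 = z := congrArg TotalSpace.proj hv
    have hcU : ∀ᶠ r in 𝓝 0, c r ∈ U :=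
      hc.continuousAt.eventually (h.isOpen.mem_nhds (hc0.symm ▸ hz.2))
    have hS : ∀ᶠ r in 𝓝 0, g (c r) = 1 ∧ f (c r) = 0 := by
      filter_upwards [hcS, hcU] with r h1 h2
      exact (h.mem_iff _ h2).1 h1
    exact ⟨mfderiv_eq_zero_of_curve (hg.mdifferentiableAt (by simp)) hc hv (hS.mono fun _ h => h.1),
      mfderiv_eq_zero_of_curve (hf.mdifferentiableAt (by simp)) hc hv (hS.mono fun _ h => h.2)⟩
  · rintro w ⟨hw1, hw2⟩
    have hg' := (hg.mdifferentiableAt (by simp)).hasMFDerivAt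
    have hf' := (hf.mdifferentiableAt (by simp)).hasMFDerivAt
    have hgf : HasMFDerivAt I 𝓘(ℝ, ℝ × (κ → ℝ)) (fun x => (g x, f x)) z _ :=
      ⟨hg'.1.prodMk hf'.1, hg'.2.prodMk hf'.2⟩
    have hs : Function.Surjective (mfderiv I 𝓘(ℝ, ℝ × (κ → ℝ)) (fun x => (g x, f x)) z) := by
      rintro ⟨a, b⟩
      obtain ⟨u, hu⟩ := hd
      let b' : κ → ℝ := mfderiv I 𝓘(ℝ, κ → ℝ) f z u
      obtain ⟨v, hv, hv'⟩ := h.independent z hz (b - a • b')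
      refine ⟨a • u + v, ?_⟩
      rw [hgf.mfderiv]
      have hv1 : mfderiv I 𝓘(ℝ, ℝ) g z v = 0 := hv
      have hu1 : mfderiv I 𝓘(ℝ, ℝ) g z u = (1 : ℝ) := hu
      refine Prod.ext ?_ ?_
      · change mfderiv I 𝓘(ℝ, ℝ) g z (a • u + v) = a
        rw [map_add, map_smul, hv1, hu1, add_zero]
        exact mul_one a
      · change mfderiv I 𝓘(ℝ, κ → ℝ) f z (a • u + v) = b
        rw [map_add, map_smul, hv']
        exact add_sub_cancel _ _
    obtain ⟨c, hc, hc1, hc2⟩ := exists_curve_of_mem_ker (hg.prodMk_space hf) hs (w := w)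
      (by rw [hgf.mfderiv]; exact Prod.ext hw1 hw2)
    have hc0 : c 0 = z := congrArg TotalSpace.proj hc2
    refine Submodule.subset_span ⟨c, hc, ?_, hc2⟩
    have hcU : ∀ᶠ r in 𝓝 0, c r ∈ U :=
      hc.continuousAt.eventually (h.isOpen.mem_nhds (hc0.symm ▸ hz.2))
    filter_upwards [hc1, hcU] with r h1 h2
    rw [h.mem_iff _ h2]
    have h3 := (h.mem_iff _ hz.2).1 hz.1
    exact ⟨(congrArg Prod.fst h1).trans h3.1, (congrArg Prod.snd h1).trans h3.2⟩

end LevelSets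

section Equations

variable {E H N : Type*} [NormedAddCommGroup E] [NormedSpace ℝ E] [TopologicalSpace H]
  {I : ModelWithCorners ℝ E H} [TopologicalSpace N] [ChartedSpace H N]

theorem DefiningEquations.reindex {κ κ' : Type} [Fintype κ] [Fintype κ'] {g : N → ℝ} {S U : Set N}
    {f : N → κ → ℝ} (h : DefiningEquations I g S U f) (e : κ' ≃ κ) :
    DefiningEquations I g S U fun z k => f z (e k) where
  isOpen := h.isOpen
  smooth := contMDiffOn_pi_space.2 fun k => contMDiffOn_pi_space.1 h.smooth (e k)
  mem_iff z hz := by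
    rw [h.mem_iff z hz]
    refine and_congr_right fun _ => ⟨fun h0 => by rw [h0]; rfl, fun h0 => funext fun k => ?_⟩
    simpa using congrFun h0 (e.symm k)
  independent z hz c := by
    obtain ⟨w, hw, hc⟩ := h.independent z hz (c ∘ e.symm)
    have h1 : MDifferentiableAt I 𝓘(ℝ, κ → ℝ) f z :=
      (h.smooth.contMDiffAt (h.isOpen.mem_nhds hz.2)).mdifferentiableAt (by simp)
    have h2 : MDifferentiableAt I 𝓘(ℝ, κ' → ℝ) (fun z k => f z (e k)) z :=
      (contMDiffAt_pi_space.2 fun k => contMDiffAt_pi_space.1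
        (h.smooth.contMDiffAt (h.isOpen.mem_nhds hz.2)) (e k)).mdifferentiableAt (by simp)
    refine ⟨w, hw, funext fun k => ?_⟩
    rw [← differential_apply_pi h2 w k]
    exact (differential_apply_pi h1 w (e k)).trans ((congrFun hc (e k)).trans (by simp))

theorem definingEquations_of_differential {κ : Type} [Fintype κ] {g : N → ℝ} {S U : Set N}
    {f : N → κ → ℝ} (hU : IsOpen U)
    (hf : ∀ z ∈ U, ∀ k, ContMDiffAt I 𝓘(ℝ, ℝ) ∞ (fun z => f z k) z)
    (hS : ∀ z ∈ U, z ∈ S ↔ g z = 1 ∧ f z = 0)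
    (hi : ∀ z ∈ U, ∀ c : κ → ℝ, ∃ w : TangentSpace I z, differential I g z w = 0 ∧
      ∀ k, differential I (fun z => f z k) z w = c k) :
    DefiningEquations I g S U f where
  isOpen := hU
  smooth := contMDiffOn_pi_space.2 fun k z hz => (hf z hz k).contMDiffWithinAt
  mem_iff := hS
  independent z hz c := by
    obtain ⟨w, hw, hc⟩ := hi z hz.2 c
    have h1 : MDifferentiableAt I 𝓘(ℝ, κ → ℝ) f z :=
      (contMDiffAt_pi_space.2 (hf z hz.2)).mdifferentiableAt (by simp)
    exact ⟨w, LinearMap.mem_ker.2 hw, funext fun k =>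
      (differential_apply_pi h1 w k).symm.trans (hc k)⟩

theorem DefiningEquations.mem_curveTangent_iff [IsManifold I ∞ N] [I.Boundaryless]
    [FiniteDimensional ℝ E] {κ : Type}
    [Fintype κ] {g : N → ℝ} {S U : Set N} {f : N → κ → ℝ} (h : DefiningEquations I g S U f)
    {z : N} (hz : z ∈ S ∩ U) (hg : ContMDiffAt I 𝓘(ℝ, ℝ) ∞ g z)
    (hd : ∃ w, differential I g z w = 1) (w : TangentSpace I z) :
    w ∈ curveTangent I S z ↔ differential I g z w = 0 ∧
      ∀ k, differential I (fun z => f z k) z w = 0 := by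
  have h1 : MDifferentiableAt I 𝓘(ℝ, κ → ℝ) f z :=
    (h.smooth.contMDiffAt (h.isOpen.mem_nhds hz.2)).mdifferentiableAt (by simp)
  rw [h.curveTangent_eq hz hg hd, Submodule.mem_inf]
  refine and_congr LinearMap.mem_ker (LinearMap.mem_ker.trans (funext_iff.trans
    (forall_congr' fun k => ?_)))
  rw [differential_apply_pi h1 w k]
  rfl

theorem flatOn_eq_zero_iff {x : N} {B : TangentSpace I x →L[ℝ] TangentSpace I x →L[ℝ] ℝ}
    {W : Submodule ℝ (TangentSpace I x)} (v : W) :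
    flatOn I B W v = 0 ↔ ∀ w ∈ W, B v w = 0 :=
  ⟨fun h w hw => DFunLike.congr_fun h ⟨w, hw⟩,
    fun h => ContinuousLinearMap.ext fun w => h w w.2⟩

theorem DefiningEquations.curveTangent_eq_inf_ker_pi [IsManifold I ∞ N] [I.Boundaryless]
    [FiniteDimensional ℝ E] {κ : Type}
    [Fintype κ] {g : N → ℝ} {S U : Set N} {f : N → κ → ℝ} (h : DefiningEquations I g S U f)
    {z : N} (hz : z ∈ S ∩ U) (hg : ContMDiffAt I 𝓘(ℝ, ℝ) ∞ g z)
    (hd : ∃ w, differential I g z w = 1) :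
    curveTangent I S z = levelTangent I g z ⊓
      LinearMap.ker (LinearMap.pi fun k => (differential I (fun z => f z k) z).toLinearMap) := by
  ext w
  rw [h.mem_curveTangent_iff hz hg hd, Submodule.mem_inf]
  refine and_congr LinearMap.mem_ker.symm (Iff.trans ?_ LinearMap.mem_ker.symm)
  exact (funext_iff (f := fun k => differential I (fun z => f z k) z w) (g := 0)).symm

end Equations

/-! ### Linear algebra of the canonical form and its complete lift -/

section LinearAlgebra

open Module

/-- A linear form on the coordinate space `(t, qⁱ, pᵢ)`. -/
theorem linear_eq_sum {n : ℕ} (l : Model n × Momenta n →L[ℝ] ℝ) (y : Model n × Momenta n) :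
    l y = l (EuclideanSpace.single 0 1, 0) * y.1 0 +
      ∑ i : Fin n, (l (EuclideanSpace.single i.succ 1, 0) * y.1 i.succ +
        l (0, EuclideanSpace.single i 1) * y.2 i) := by
  have hy : y = y.1 0 • ((EuclideanSpace.single 0 1, 0) : Model n × Momenta n) +
      ∑ i : Fin n, (y.1 i.succ • ((EuclideanSpace.single i.succ 1, 0) : Model n × Momenta n) +
        y.2 i • ((0, EuclideanSpace.single i 1) : Model n × Momenta n)) := by
    refine Prod.ext ?_ ?_
    · ext j
      refine Fin.cases ?_ (fun j => ?_) j
      · simp [Prod.fst_sum]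
      · simp [Prod.fst_sum, Pi.single_apply]
    · ext j
      simp [Prod.snd_sum, Pi.single_apply]
  conv_lhs => rw [hy]
  simp only [map_add, map_sum, map_smul, smul_eq_mul, mul_comm]

/-- Comparison of the coefficients of `∑ (uⱼ dpⱼ - vⱼ dqⱼ)` and of `dp₀ + dH`, where `u₀ = 1`. -/
theorem wedge_eq_iff {n : ℕ} {W : Type*} {dq dp : Fin (n + 1) → W → ℝ}
    (hs : ∀ a b : Fin (n + 1) → ℝ, ∃ w, (∀ j, dq j w = a j) ∧ ∀ j, dp j w = b j)
    {u v : Fin (n + 1) → ℝ} (hu : u 0 = 1) {Ht : ℝ} {Hq Hp : Fin n → ℝ} :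
    (∀ w, ∑ j, (u j * dp j w - dq j w * v j) =
      dp 0 w + (Ht * dq 0 w + ∑ i : Fin n, (Hq i * dq i.succ w + Hp i * dp i.succ w))) ↔
    (∀ i, u (Fin.succ i) = Hp i) ∧ (∀ i, v (Fin.succ i) = -Hq i) ∧ v 0 = -Ht := by
  simp only [Fin.sum_univ_succ, hu]
  constructor
  · intro h
    refine ⟨fun i => ?_, fun i => ?_, ?_⟩
    · obtain ⟨w, hq, hp⟩ := hs 0 (Pi.single i.succ 1)
      simpa [hq, hp, Pi.single_apply] using h w
    · obtain ⟨w, hq, hp⟩ := hs (Pi.single i.succ 1) 0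
      have := h w
      simp [hq, hp, Pi.single_apply] at this
      linarith
    · obtain ⟨w, hq, hp⟩ := hs (Pi.single 0 1) 0
      have := h w
      simp [hq, hp] at this
      linarith
  · rintro ⟨h1, h2, h3⟩ w
    simp only [h1, h2, h3]
    rw [sub_eq_add_neg, add_assoc]
    congr 1
    · ring
    congr 1
    · ring
    · exact Finset.sum_congr rfl fun i _ => by ring

/-- The Hessian of the Hamiltonian is symmetric, so the form `∑ (dq̇ⱼ ∧ dpⱼ + dqⱼ ∧ dṗⱼ)` vanishes on
pairs of solutions of the linearized Hamilton equations. -/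
theorem sum_wedge_eq_zero {n : ℕ} {B : Model n × Momenta n →L[ℝ] Model n × Momenta n →L[ℝ] ℝ}
    (hB : ∀ x y, B x y = B y x) {x y : Model n × Momenta n} {q p q' p' r s r' s' : Fin (n + 1) → ℝ}
    (hq : ∀ j, x.1 j = q j) (hp : ∀ i, x.2 i = p i.succ) (h0 : q' 0 = 0)
    (hq' : ∀ i : Fin n, q' i.succ = B x (0, EuclideanSpace.single i 1))
    (hp' : ∀ j, p' j = -B x (EuclideanSpace.single j 1, 0))
    (hr : ∀ j, y.1 j = r j) (hs : ∀ i, y.2 i = s i.succ) (h0' : r' 0 = 0)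
    (hr' : ∀ i : Fin n, r' i.succ = B y (0, EuclideanSpace.single i 1))
    (hs' : ∀ j, s' j = -B y (EuclideanSpace.single j 1, 0)) :
    ∑ j, (q' j * s j - r' j * p j + (q j * s' j - r j * p' j)) = 0 := by
  have h1 := linear_eq_sum (B x) y
  have h2 := linear_eq_sum (B y) x
  rw [hB x y, h2] at h1
  simp only [hq, hp, hr, hs] at h1
  rw [← sub_eq_zero, add_sub_add_comm, ← Finset.sum_sub_distrib] at h1
  rw [Fin.sum_univ_succ, ← neg_eq_zero, ← h1, neg_add, ← Finset.sum_neg_distrib]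
  simp only [h0, h0', hq', hr', hp', hs']
  congr 1
  · ring
  · exact Finset.sum_congr rfl fun i _ => by ring

theorem finrank_model_tangent (n : ℕ) : Module.finrank ℝ
    ((Model n × (Model n →L[ℝ] ℝ)) × (Model n × (Model n →L[ℝ] ℝ))) = 4 * (n + 1) := by
  have h1 : Module.finrank ℝ (Model n →L[ℝ] ℝ) = n + 1 := by
    rw [← (LinearMap.toContinuousLinearMap (𝕜 := ℝ) (E := Model n) (F' := ℝ)).finrank_eq,
      Module.finrank_linearMap_self]
    simp
  simp only [Module.finrank_prod, h1, finrank_euclideanSpace_fin]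
  ring

theorem finrank_ker_add {V G : Type*} [AddCommGroup V] [Module ℝ V] [FiniteDimensional ℝ V]
    [AddCommGroup G] [Module ℝ G] (L : V →ₗ[ℝ] G) (hL : Function.Surjective L) :
    finrank ℝ G + finrank ℝ (LinearMap.ker L) = finrank ℝ V := by
  rw [← L.finrank_range_add_finrank_ker, LinearMap.range_eq_top.2 hL, finrank_top]

/-- The dimension count for the form `∑ (dq̇ⱼ ∧ dpⱼ + dqⱼ ∧ dṗⱼ)` on the hyperplane `dq̇₀ = 0`: its
kernel there is the line on which all coordinates but `p₀` vanish, so that the rank is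
`4 n + 2`. -/
theorem two_mul_finrank_eq {n : ℕ} {V D : Type*} [AddCommGroup V] [Module ℝ V]
    [FiniteDimensional ℝ V] [AddCommGroup D] [Module ℝ D]
    (hV : finrank ℝ V = 4 * (n + 1)) {dq dp dq' dp' : Fin (n + 1) → V →ₗ[ℝ] ℝ}
    (hs : ∀ a b c d : Fin (n + 1) → ℝ, ∃ w, (∀ j, dq j w = a j) ∧ (∀ j, dp j w = b j) ∧
      (∀ j, dq' j w = c j) ∧ ∀ j, dp' j w = d j)
    {W T : Submodule ℝ V} (hW : ∀ v, v ∈ W ↔ dq' 0 v = 0)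
    {F : W →ₗ[ℝ] D} (hF : ∀ v : W, F v = 0 ↔ ∀ w ∈ W, ∑ j,
      (dq' j v * dp j w - dq' j w * dp j v + (dq j v * dp' j w - dq j w * dp' j v)) = 0)
    {κ : Type*} [Fintype κ] (hκ : Fintype.card κ = 2 * n + 1) {L : V →ₗ[ℝ] κ → ℝ}
    (hL : ∀ c, ∃ w ∈ W, L w = c) (hT : T = W ⊓ LinearMap.ker L)
    (hk : ∀ v, (∀ j, dq j v = 0) → (∀ i : Fin n, dp i.succ v = 0) → (∀ j, dq' j v = 0) →
      (∀ j, dp' j v = 0) → v ∈ T) :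
    2 * finrank ℝ T = finrank ℝ (LinearMap.range F) +
      2 * finrank ℝ (T ⊓ (LinearMap.ker F).map W.subtype : Submodule ℝ V) := by
  have hWs : Function.Surjective (dq' 0) := fun r => by
    obtain ⟨w, -, -, hw, -⟩ := hs 0 0 (fun _ => r) 0
    exact ⟨w, hw 0⟩
  have hWk : W = LinearMap.ker (dq' 0) := by ext v; exact hW v
  have hdW : 1 + finrank ℝ W = 4 * (n + 1) := by
    have := finrank_ker_add _ hWs
    rwa [← hWk, hV, finrank_self] at this
  have hdT : (2 * n + 2) + finrank ℝ T = 4 * (n + 1) := by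
    have h1 : Function.Surjective ((dq' 0).prod L) := by
      rintro ⟨r, c⟩
      obtain ⟨u, hu⟩ := hWs r
      obtain ⟨w, hw, hw'⟩ := hL (c - L u)
      refine ⟨u + w, Prod.ext ?_ ?_⟩
      · simp [hu, (hW w).1 hw]
      · simp [hw']
    have h2 := finrank_ker_add _ h1
    rw [LinearMap.ker_prod, ← hWk, ← hT, hV, finrank_prod, finrank_self, finrank_fintype_fun_eq_card,
      hκ] at h2
    omega
  -- The map `K` collects all coordinates but `p₀`; its kernel is the kernel of the restricted form.
  let K : V →ₗ[ℝ] ((Fin (n + 1) → ℝ) × (Fin n → ℝ)) × (Fin (n + 1) → ℝ) × (Fin (n + 1) → ℝ) :=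
    ((LinearMap.pi dq).prod (LinearMap.pi fun i : Fin n => dp i.succ)).prod
      ((LinearMap.pi dq').prod (LinearMap.pi dp'))
  have hK (v : V) : v ∈ LinearMap.ker K ↔ (∀ j, dq j v = 0) ∧ (∀ i : Fin n, dp i.succ v = 0) ∧
      (∀ j, dq' j v = 0) ∧ ∀ j, dp' j v = 0 := by
    simp [K, LinearMap.mem_ker, funext_iff, and_assoc]
  have hdK : finrank ℝ (LinearMap.ker K) = 1 := by
    have h1 : Function.Surjective K := by
      rintro ⟨⟨a, b⟩, c, d⟩
      obtain ⟨w, hw1, hw2, hw3, hw4⟩ := hs a (Fin.cons 0 b) c d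
      refine ⟨w, Prod.ext (Prod.ext (funext hw1) (funext fun i => ?_))
        (Prod.ext (funext hw3) (funext hw4))⟩
      exact hw2 i.succ
    have h2 := finrank_ker_add _ h1
    simp only [finrank_prod, finrank_fintype_fun_eq_card, Fintype.card_fin, hV] at h2
    omega
  have hmap : (LinearMap.ker F).map W.subtype = LinearMap.ker K := by
    ext v
    rw [hK]
    constructor
    · rintro ⟨⟨v, hv⟩, hFv, rfl⟩
      have h1 := (hF ⟨v, hv⟩).1 hFv
      simp only at h1
      have hv0 := (hW v).1 hv
      refine ⟨fun j => ?_, fun i => ?_, fun j => ?_, fun j => ?_⟩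
      -- Each coordinate of `v` is, up to sign, the pairing of `v` with a dual vector in `W`; the one
      -- for `p₀` is missing, as it would need `dq̇₀ ≠ 0`.
      · obtain ⟨w, hw1, hw2, hw3, hw4⟩ := hs 0 0 0 (Pi.single j 1)
        have h2 := h1 w ((hW w).2 (by simp [hw3]))
        simpa [hw1, hw2, hw3, hw4, Pi.single_apply] using h2
      · obtain ⟨w, hw1, hw2, hw3, hw4⟩ := hs 0 0 (Pi.single i.succ 1) 0
        have h2 := h1 w ((hW w).2 (by simp [hw3, (Fin.succ_ne_zero i).symm]))
        simpa [hw1, hw2, hw3, hw4, Pi.single_apply] using h2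
      · obtain ⟨w, hw1, hw2, hw3, hw4⟩ := hs 0 (Pi.single j 1) 0 0
        have h2 := h1 w ((hW w).2 (by simp [hw3]))
        simpa [hw1, hw2, hw3, hw4, Pi.single_apply] using h2
      · obtain ⟨w, hw1, hw2, hw3, hw4⟩ := hs (Pi.single j 1) 0 0 0
        have h2 := h1 w ((hW w).2 (by simp [hw3]))
        simpa [hw1, hw2, hw3, hw4, Pi.single_apply] using h2
    · rintro ⟨h1, h2, h3, h4⟩
      refine ⟨⟨v, (hW v).2 (h3 0)⟩, (hF _).2 fun w hw => ?_, rfl⟩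
      refine Finset.sum_eq_zero fun j _ => ?_
      refine Fin.cases ?_ (fun i => ?_) j
      · simp [h1, h3, h4, (hW w).1 hw]
      · simp [h1, h2, h3, h4]
  have hle : LinearMap.ker K ≤ T := fun v hv => by
    obtain ⟨h1, h2, h3, h4⟩ := (hK v).1 hv
    exact hk v h1 h2 h3 h4
  have hdF := F.finrank_range_add_finrank_ker
  have hdF' : finrank ℝ (LinearMap.ker F) = 1 := by
    rw [← hdK, ← hmap]
    exact (Submodule.equivMapOfInjective W.subtype W.injective_subtype (LinearMap.ker F)).finrank_eq
  rw [hmap, inf_eq_right.2 hle, hdK]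
  omega

end LinearAlgebra

/-! ### Coordinates on the cotangent bundle -/

/-! The following instances are found by instance search, at a high cost. They are scoped, so that
the statements outside this namespace do not refer to them. -/

section Instances

variable (n : ℕ) (M : Type*) [TopologicalSpace M] [ChartedSpace (Model n) M]
  [IsManifold (𝓡 (n + 1)) ∞ M]

scoped instance instTopologicalSpaceTStar : TopologicalSpace (TStar n M) := inferInstance

scoped instance instChartedSpaceTStar :
    ChartedSpace (ModelProd (Model n) (Model n →L[ℝ] ℝ)) (TStar n M) := inferInstance

scoped instance instIsManifoldTStar : IsManifold (IT n) ∞ (TStar n M) := inferInstance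

scoped instance instIsManifoldOneTStar : IsManifold (IT n) 1 (TStar n M) := inferInstance

scoped instance instTopologicalSpaceTangentTStar :
    TopologicalSpace (TangentBundle (IT n) (TStar n M)) := inferInstance

scoped instance instChartedSpaceTangentTStar :
    ChartedSpace (ModelProd (ModelProd (Model n) (Model n →L[ℝ] ℝ)) (Model n × (Model n →L[ℝ] ℝ)))
      (TangentBundle (IT n) (TStar n M)) := inferInstance

scoped instance instIsManifoldTangentTStar :
    IsManifold (IT n).tangent ∞ (TangentBundle (IT n) (TStar n M)) := inferInstance

end Instances

variable {n : ℕ} {M : Type*} [TopologicalSpace M] [ChartedSpace (Model n) M]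
  [IsManifold (𝓡 (n + 1)) ∞ M]

/-- Smoothness of a map to `T*M`, in terms of the trivialization of `TM` given by a chart. -/
theorem contMDiffAt_TStar_iff {EN HN N : Type*} [NormedAddCommGroup EN] [NormedSpace ℝ EN]
    [TopologicalSpace HN] {J : ModelWithCorners ℝ EN HN} [TopologicalSpace N] [ChartedSpace HN N]
    {f : N → TStar n M} {p : N} :
    ContMDiffAt J (IT n) ∞ f p ↔ ContMDiffAt J (𝓡 (n + 1)) ∞ (fun x => (f x).1) p ∧
      ContMDiffAt J 𝓘(ℝ, Model n →L[ℝ] ℝ) ∞ (fun x => ((f x).2.comp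
        ((trivializationAt (Model n) (TangentSpace (𝓡 (n + 1))) (f p).1).symmL ℝ (f x).1) :
          Model n →L[ℝ] ℝ)) p := by
  refine (contMDiffAt_hom_bundle f).trans (and_congr Iff.rfl ?_)
  refine iff_of_eq (congrArg (fun g => ContMDiffAt J 𝓘(ℝ, Model n →L[ℝ] ℝ) ∞ g p) ?_)
  funext x
  simp [ContinuousLinearMap.inCoordinates]

namespace Fibration.AdaptedChart

variable {P : Fibration n M} (φ : P.AdaptedChart)

/-- The Jacobian at `y` of the coordinates of `φ`, with respect to the preferred chart of `M` at
`x`. -/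
def jacobian (x y : M) : Model n →L[ℝ] Model n :=
  fderiv ℝ (φ.chart ∘ (extChartAt (𝓡 (n + 1)) x).symm) (extChartAt (𝓡 (n + 1)) x y)

omit [IsManifold (𝓡 (n + 1)) ∞ M] in
theorem contMDiffAt_chart {x : M} (hx : x ∈ φ.chart.source) :
    ContMDiffAt (𝓡 (n + 1)) (𝓡 (n + 1)) ∞ φ.chart x :=
  φ.contMDiffOn.contMDiffAt (φ.chart.open_source.mem_nhds hx)

theorem contMDiffAt_jacobian {x : M} (hx : x ∈ φ.chart.source) :
    ContMDiffAt (𝓡 (n + 1)) 𝓘(ℝ, Model n →L[ℝ] Model n) ∞ (φ.jacobian x) x := by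
  have h := contDiffAt_comp_extChartAt_symm (mem_chart_source (Model n) x) (φ.contMDiffAt_chart hx)
  exact (h.fderiv_right (m := ∞) (by simp)).contMDiffAt.comp x contMDiffAt_extChartAt

theorem coframe_eq_jacobian {x y : M} (hx : y ∈ (chartAt (Model n) x).source)
    (hy : y ∈ φ.chart.source) (v : TangentSpace (𝓡 (n + 1)) y) :
    φ.coframe y v = φ.jacobian x y ((trivializationAt (Model n)
      (TangentSpace (𝓡 (n + 1))) x).continuousLinearMapAt ℝ y v) := by
  rw [TangentBundle.continuousLinearMapAt_trivializationAt hx]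
  exact DFunLike.congr_fun (mfderiv_eq_fderiv_comp hx
    ((φ.contMDiffAt_chart hy).mdifferentiableAt (by simp))) v

theorem coframe_symmL {x y : M} (hx : y ∈ (chartAt (Model n) x).source)
    (hy : y ∈ φ.chart.source) (v : Model n) :
    φ.coframe y ((trivializationAt (Model n)
      (TangentSpace (𝓡 (n + 1))) x).symmL ℝ y v) = φ.jacobian x y v := by
  have hy' : y ∈ (trivializationAt (Model n) (TangentSpace (𝓡 (n + 1))) x).baseSet := by
    rwa [TangentBundle.trivializationAt_baseSet]
  rw [φ.coframe_eq_jacobian hx hy, Trivialization.continuousLinearMapAt_symmL _ hy']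

theorem isInvertible_jacobian {x y : M} (hx : y ∈ (chartAt (Model n) x).source)
    (hy : y ∈ φ.chart.source) : (φ.jacobian x y).IsInvertible := by
  have hy' : y ∈ (trivializationAt (Model n) (TangentSpace (𝓡 (n + 1))) x).baseSet := by
    rwa [TangentBundle.trivializationAt_baseSet]
  obtain ⟨A, hA⟩ := φ.isInvertible_coframe hy
  refine ⟨((trivializationAt (Model n) (TangentSpace (𝓡 (n + 1))) x).continuousLinearEquivAt ℝ y
    hy').symm.trans A, ContinuousLinearMap.ext fun v => ?_⟩
  rw [← φ.coframe_symmL hx hy, ← hA]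
  exact congrArg A (congrFun (Trivialization.symm_continuousLinearEquivAt_eq
    (R := ℝ) _ hy') v)

theorem frame_eq_symmL {x y : M} (hx : y ∈ (chartAt (Model n) x).source)
    (hy : y ∈ φ.chart.source) (j : Fin (n + 1)) :
    φ.frame y j = (trivializationAt (Model n) (TangentSpace (𝓡 (n + 1))) x).symmL ℝ y
      ((φ.jacobian x y).inverse (EuclideanSpace.single j 1)) := by
  apply φ.coframe_injective hy
  rw [φ.coframe_frame hy, φ.coframe_symmL hx hy,
    (φ.isInvertible_jacobian hx hy).self_apply_inverse]

theorem contMDiffAt_qT {α : TStar n M} (hα : α.1 ∈ φ.chart.source) (j : Fin (n + 1)) :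
    ContMDiffAt (IT n) 𝓘(ℝ, ℝ) ∞ (φ.qT j) α := by
  have h1 := (φ.contMDiffAt_chart hα).comp α
    (contMDiffAt_proj (n := ∞) (IB := 𝓡 (n + 1)) (fun x : M => TangentSpace (𝓡 (n + 1)) x →L[ℝ] ℝ))
  exact (EuclideanSpace.proj (𝕜 := ℝ) j).contDiff.contDiffAt.contMDiffAt.comp α h1

/-- In the trivialization of `T*M` at `α`, `pⱼ` is the value of a covector on the `j`-th column of
the inverse of the Jacobian of `φ`. -/
theorem contMDiffAt_pT {α : TStar n M} (hα : α.1 ∈ φ.chart.source) (j : Fin (n + 1)) :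
    ContMDiffAt (IT n) 𝓘(ℝ, ℝ) ∞ (φ.pT j) α := by
  have hp : ContMDiffAt (IT n) (𝓡 (n + 1)) ∞ (fun β : TStar n M => β.1) α :=
    contMDiffAt_proj _
  have h1 := (contMDiffAt_TStar_iff.1 (contMDiffAt_id (I := IT n) (x := α))).2
  obtain ⟨A, hA⟩ := φ.isInvertible_jacobian (mem_chart_source (Model n) α.1) hα
  have h2 : ContMDiffAt (IT n) 𝓘(ℝ, Model n →L[ℝ] Model n) ∞
      (fun β : TStar n M => (φ.jacobian α.1 β.1).inverse) α := by
    have h3 : ContDiffAt ℝ ∞ ContinuousLinearMap.inverse (φ.jacobian α.1 α.1) := by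
      rw [← hA]; exact contDiffAt_map_inverse A
    exact h3.contMDiffAt.comp α ((φ.contMDiffAt_jacobian hα).comp α hp)
  have h4 := h1.clm_apply (h2.clm_apply (contMDiffAt_const (c := EuclideanSpace.single j (1 : ℝ))))
  refine h4.congr_of_eventuallyEq ?_
  filter_upwards [hp.continuousAt.eventually (chart_source_mem_nhds (Model n) α.1),
    hp.continuousAt.eventually (φ.chart.open_source.mem_nhds hα)] with β h5 h6
  exact congrArg β.2 (φ.frame_eq_symmL h5 h6 j)

/-- The covector with coordinates `y.1 = (t, qⁱ)` and `y.2 = (p, pᵢ)`: the inverse, over the domain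
of the chart, of the coordinate map of `T*M`. -/
def ofCoordT (y : Model n × Model n) : TStar n M :=
  ⟨φ.chart.symm y.1, (innerSL ℝ y.2).comp (φ.coframe (φ.chart.symm y.1))⟩

omit [IsManifold (𝓡 (n + 1)) ∞ M] in
theorem qT_ofCoordT {y : Model n × Model n} (hy : y.1 ∈ φ.chart.target) (j : Fin (n + 1)) :
    φ.qT j (φ.ofCoordT y) = y.1 j := by
  simp [qT, ofCoordT, hy]

omit [IsManifold (𝓡 (n + 1)) ∞ M] in
theorem pT_ofCoordT {y : Model n × Model n} (hy : y.1 ∈ φ.chart.target) (j : Fin (n + 1)) :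
    φ.pT j (φ.ofCoordT y) = y.2 j := by
  have h := φ.coframe_frame (φ.chart.map_target hy)
  refine (congrArg (innerSL ℝ y.2) (h j)).trans ?_
  simp [PiLp.inner_apply]

omit [IsManifold (𝓡 (n + 1)) ∞ M] in
theorem apply_eq_sum {x : M} (hx : x ∈ φ.chart.source) (a : TangentSpace (𝓡 (n + 1)) x →L[ℝ] ℝ)
    (v : TangentSpace (𝓡 (n + 1)) x) : a v = ∑ j, a (φ.frame x j) * φ.coframe x v j := by
  have hv : v = ∑ j, φ.coframe x v j • φ.frame x j := by
    apply φ.coframe_injective hx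
    rw [map_sum]
    ext k
    simp [φ.coframe_frame hx, Pi.single_apply]
  conv_lhs => rw [hv, map_sum]
  simp [mul_comm]

omit [IsManifold (𝓡 (n + 1)) ∞ M] in
theorem ofCoordT_coord {α : TStar n M} (hα : α.1 ∈ φ.chart.source) :
    φ.ofCoordT (φ.chart α.1, WithLp.toLp 2 fun j => φ.pT j α) = α := by
  obtain ⟨x, a⟩ := α
  have hx : φ.chart.symm (φ.chart x) = x := φ.chart.left_inv hα
  simp only [ofCoordT]
  rw [hx]
  refine congrArg (TotalSpace.mk x) (ContinuousLinearMap.ext fun v => ?_)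
  rw [φ.apply_eq_sum hα a v]
  simp [pT, PiLp.inner_apply, mul_comm]

theorem contMDiffAt_ofCoordT {y : Model n × Model n} (hy : y.1 ∈ φ.chart.target) :
    ContMDiffAt 𝓘(ℝ, Model n × Model n) (IT n) ∞ φ.ofCoordT y := by
  have hx := φ.chart.map_target hy
  have h1 : ContMDiffAt 𝓘(ℝ, Model n × Model n) (𝓡 (n + 1)) ∞
      (fun u : Model n × Model n => φ.chart.symm u.1) y :=
    ((contMDiffOn_symm_of_mem_maximalAtlas φ.mem_maximalAtlas).contMDiffAt
      (φ.chart.open_target.mem_nhds hy)).comp y contDiffAt_fst.contMDiffAt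
  refine contMDiffAt_TStar_iff.2 ⟨h1, ?_⟩
  have h2 := (φ.contMDiffAt_jacobian hx).comp y h1
  have h3 : ContMDiffAt 𝓘(ℝ, Model n × Model n) 𝓘(ℝ, Model n →L[ℝ] ℝ) ∞
      (fun u : Model n × Model n => innerSL ℝ u.2) y :=
    ((innerSL ℝ).contDiff.contDiffAt.comp y contDiffAt_snd).contMDiffAt
  refine (h3.clm_comp h2).congr_of_eventuallyEq ?_
  filter_upwards [h1.continuousAt.eventually (chart_source_mem_nhds (Model n) _),
    continuousAt_fst.eventually (φ.chart.open_target.mem_nhds hy)] with u h4 h5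
  exact ContinuousLinearMap.ext fun v =>
    congrArg (innerSL ℝ u.2) (φ.coframe_symmL h4 (φ.chart.map_target h5) v)

/-- The differentials of the coordinates of `T*M` are independent, because the coordinate map has
the smooth right inverse `ofCoordT`. -/
theorem exists_tangent_coordT {α : TStar n M} (hα : α.1 ∈ φ.chart.source)
    (a : Fin (n + 1) ⊕ Fin (n + 1) → ℝ) : ∃ v : TangentSpace (IT n) α, ∀ i,
      differential (IT n) (Sum.elim φ.qT φ.pT i) α v = a i := by
  let y : Model n × Model n := (φ.chart α.1, WithLp.toLp 2 fun j => φ.pT j α)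
  have hy : y.1 ∈ φ.chart.target := φ.chart.map_source hα
  have hyα : φ.ofCoordT y = α := φ.ofCoordT_coord hα
  clear_value y
  subst hyα
  have h1 := ((φ.contMDiffAt_ofCoordT hy).mdifferentiableAt (by simp)).hasMFDerivAt
  let b : Model n × Model n := (WithLp.toLp 2 fun j => a (.inl j), WithLp.toLp 2 fun j => a (.inr j))
  refine ⟨mfderiv 𝓘(ℝ, Model n × Model n) (IT n) φ.ofCoordT y b, ?_⟩
  have h2 : ∀ᶠ u in 𝓝 y, u.1 ∈ φ.chart.target :=
    continuousAt_fst.eventually (φ.chart.open_target.mem_nhds hy)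
  rintro (j | j)
  · have h3 := ((φ.contMDiffAt_qT hα j).mdifferentiableAt (by simp)).hasMFDerivAt.comp y h1
    have h4 : φ.qT j ∘ φ.ofCoordT =ᶠ[𝓝 y] ((EuclideanSpace.proj (𝕜 := ℝ) j).comp
        (ContinuousLinearMap.fst ℝ (Model n) (Model n))) := by
      filter_upwards [h2] with u hu
      exact φ.qT_ofCoordT hu j
    have h5 := h3.mfderiv
    rw [h4.mfderiv_eq, ContinuousLinearMap.mfderiv_eq] at h5
    exact (DFunLike.congr_fun h5 b).symm
  · have h3 := ((φ.contMDiffAt_pT hα j).mdifferentiableAt (by simp)).hasMFDerivAt.comp y h1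
    have h4 : φ.pT j ∘ φ.ofCoordT =ᶠ[𝓝 y] ((EuclideanSpace.proj (𝕜 := ℝ) j).comp
        (ContinuousLinearMap.snd ℝ (Model n) (Model n))) := by
      filter_upwards [h2] with u hu
      exact φ.pT_ofCoordT hu j
    have h5 := h3.mfderiv
    rw [h4.mfderiv_eq, ContinuousLinearMap.mfderiv_eq] at h5
    exact (DFunLike.congr_fun h5 b).symm

theorem differential_qT {α : TStar n M} (hα : α.1 ∈ φ.chart.source) (j : Fin (n + 1))
    (v : TangentSpace (IT n) α) : differential (IT n) (φ.qT j) α v =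
      φ.coframe α.1 (mfderiv (IT n) (𝓡 (n + 1)) (TotalSpace.proj : TStar n M → M) α v) j := by
  have hp : ContMDiffAt (IT n) (𝓡 (n + 1)) ∞ (TotalSpace.proj : TStar n M → M) α :=
    contMDiffAt_proj _
  have h1 := ((EuclideanSpace.proj (𝕜 := ℝ) j).hasMFDerivAt).comp α
    ((((φ.contMDiffAt_chart hα).mdifferentiableAt (by simp)).hasMFDerivAt).comp α
      (hp.mdifferentiableAt (by simp)).hasMFDerivAt)
  exact DFunLike.congr_fun h1.mfderiv v

/-- The Liouville form is `p dt + ∑ pᵢ dqⁱ`. -/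
theorem liouville_eq {α : TStar n M} (hα : α.1 ∈ φ.chart.source) (v : TangentSpace (IT n) α) :
    liouville α v = ∑ j, φ.pT j α * differential (IT n) (φ.qT j) α v := by
  simp only [φ.differential_qT hα]
  exact φ.apply_eq_sum hα α.2 _

/-- The canonical symplectic form is `dt ∧ dp + ∑ dqⁱ ∧ dpᵢ`. -/
theorem canonicalForm_eq {α : TStar n M} (hα : α.1 ∈ φ.chart.source)
    (v w : TangentSpace (IT n) α) :
    canonicalForm α v w = ∑ j,
      (differential (IT n) (φ.qT j) α v * differential (IT n) (φ.pT j) α w -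
        differential (IT n) (φ.qT j) α w * differential (IT n) (φ.pT j) α v) := by
  have hp : ContMDiffAt (IT n) (𝓡 (n + 1)) ∞ (TotalSpace.proj : TStar n M → M) α :=
    contMDiffAt_proj _
  have h := extDerivOne_eq_sum (θ := liouville) (fun j => φ.contMDiffAt_pT hα j)
    (fun j => φ.contMDiffAt_qT hα j) (by
      filter_upwards [hp.continuousAt.eventually (φ.chart.open_source.mem_nhds hα)] with β hβ
      exact φ.liouville_eq hβ) v w
  change -(extDerivOne liouville α v w) = _
  rw [h, ← Finset.sum_neg_distrib]
  exact Finset.sum_congr rfl fun j _ => by ring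

end Fibration.AdaptedChart

/-! ### The local Hamiltonian and the function `F_h` -/

namespace Fibration.AdaptedChart

variable {P : Fibration n M} (φ : P.AdaptedChart) (h : P.HamiltonianSection)

/-- The map `(t, qⁱ, pᵢ) ↦ β` given by an adapted chart is smooth: it is the inverse of the local
trivialization of `V*π` attached to the chart. -/
theorem contMDiffAt_ofMomenta {y : Model n × Momenta n} (hy : y.1 ∈ φ.chart.target) :
    ContMDiffAt 𝓘(ℝ, Model n × Momenta n) (IV n) ∞
      (fun y : Model n × Momenta n =>
        (⟨φ.chart.symm y.1, φ.ofMomenta (φ.chart.symm y.1) y.2⟩ : P.VStar)) y := by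
  let e := P.prebundle.trivializationOfMemPretrivializationAtlas ⟨φ, rfl⟩
  have : MemTrivializationAtlas e := ⟨⟨_, ⟨φ, rfl⟩, rfl⟩⟩
  have h1 : ContMDiffAt 𝓘(ℝ, Model n × Momenta n) (𝓡 (n + 1)) ∞
      (fun u : Model n × Momenta n => φ.chart.symm u.1) y :=
    ((contMDiffOn_symm_of_mem_maximalAtlas φ.mem_maximalAtlas).contMDiffAt
      (φ.chart.open_target.mem_nhds hy)).comp y contDiffAt_fst.contMDiffAt
  have hy' : (⟨φ.chart.symm y.1, φ.ofMomenta (φ.chart.symm y.1) y.2⟩ : P.VStar) ∈ e.source :=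
    φ.chart.map_target hy
  refine (Trivialization.contMDiffAt_iff (e := e) (f := fun y : Model n × Momenta n =>
    (⟨φ.chart.symm y.1, φ.ofMomenta (φ.chart.symm y.1) y.2⟩ : P.VStar)) hy').2 ⟨h1, ?_⟩
  refine (contDiffAt_snd.contMDiffAt).congr_of_eventuallyEq ?_
  filter_upwards [continuousAt_fst.eventually (φ.chart.open_target.mem_nhds hy)] with u hu
  exact φ.momenta_ofMomenta (φ.chart.map_target hu) u.2

theorem toFun_fst (β : P.VStar) : (h.toFun β).1 = β.1 :=
  congrArg TotalSpace.proj (h.section_eq β)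

theorem contDiffAt_ham {y : Model n × Momenta n} (hy : y.1 ∈ φ.chart.target) :
    ContDiffAt ℝ ∞ (φ.ham h) y := by
  rw [← contMDiffAt_iff_contDiffAt]
  refine ContMDiffAt.neg ?_
  refine ContMDiffAt.comp y (φ.contMDiffAt_pT ?_ 0)
    ((h.contMDiff _).comp y (φ.contMDiffAt_ofMomenta hy))
  rw [toFun_fst]
  exact φ.chart.map_target hy

theorem ham_coordV {β : P.VStar} (hβ : β.1 ∈ φ.chart.source) :
    φ.ham h (φ.coordV β) = -φ.pT 0 (h.toFun β) := by
  have h1 : (⟨φ.chart.symm (φ.chart β.1), φ.ofMomenta (φ.chart.symm (φ.chart β.1)) (φ.momenta β)⟩ :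
      P.VStar) = β := by
    rw [φ.chart.left_inv hβ, φ.ofMomenta_momenta hβ]
  simp only [ham, coordV]
  rw [h1]

/-- The coordinates `(t, qⁱ, pᵢ)` of the image under `μ` of a covector. -/
def coordMu (α : TStar n M) : Model n × Momenta n :=
  (WithLp.toLp 2 fun j => φ.qT j α, WithLp.toLp 2 fun i : Fin n => φ.pT i.succ α)

omit [IsManifold (𝓡 (n + 1)) ∞ M] in
theorem coordV_mu {α : TStar n M} (hα : α.1 ∈ φ.chart.source) :
    φ.coordV (P.mu α) = φ.coordMu α := by
  refine Prod.ext rfl ?_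
  ext i
  have hx : (P.mu α).1 ∈ φ.chart.source := hα
  simp only [coordV, momenta, vframe, dif_pos hx]
  rfl

omit [IsManifold (𝓡 (n + 1)) ∞ M] in
theorem pT_act {α : TStar n M} (hα : α.1 ∈ φ.chart.source) (c : ℝ) :
    φ.pT 0 (P.act c α) = φ.pT 0 α + c := by
  have h4 := φ.dt_eq hα (φ.frame α.1 0)
  rw [φ.coframe_frame hα] at h4
  change α.2 (φ.frame α.1 0) + c * P.dt α.1 (φ.frame α.1 0) = α.2 (φ.frame α.1 0) + c
  rw [h4]
  simp

/-- The function `F_h` is `p + H`. -/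
theorem energy_eq {α : TStar n M} (hα : α.1 ∈ φ.chart.source) :
    h.energy α = φ.pT 0 α + φ.ham h (φ.coordMu α) := by
  have h1 : α = P.act (h.energy α) (h.toFun (P.mu α)) := (h.exists_energy α).choose_spec
  have h2 := φ.pT_act (α := h.toFun (P.mu α)) (by rw [toFun_fst]; exact hα) (h.energy α)
  rw [← h1] at h2
  rw [← φ.coordV_mu hα, φ.ham_coordV h hα, h2]
  ring

theorem isOpen_source : IsOpen {α : TStar n M | α.1 ∈ φ.chart.source} :=
  φ.chart.open_source.preimage
    (contMDiff_proj (n := ∞) (IB := 𝓡 (n + 1))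
      (fun x : M => TangentSpace (𝓡 (n + 1)) x →L[ℝ] ℝ)).continuous

theorem eventually_mem_source {α : TStar n M} (hα : α.1 ∈ φ.chart.source) :
    ∀ᶠ β in 𝓝 α, β.1 ∈ φ.chart.source := φ.isOpen_source.mem_nhds hα

/-- The value of the differential of `coordMu` on a vector `v`, written through the differentials of
the coordinate functions; it is the derivative of `coordMu` by `mfderiv_coordMu`. -/
def dCoordMu (α : TStar n M) (v : TangentSpace (IT n) α) : Model n × Momenta n :=
  (WithLp.toLp 2 fun j => differential (IT n) (φ.qT j) α v,
    WithLp.toLp 2 fun i : Fin n => differential (IT n) (φ.pT i.succ) α v)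

theorem contMDiffAt_coordMu {α : TStar n M} (hα : α.1 ∈ φ.chart.source) :
    ContMDiffAt (IT n) 𝓘(ℝ, Model n × Momenta n) ∞ φ.coordMu α := by
  have h1 : ContMDiffAt (IT n) 𝓘(ℝ, Fin (n + 1) → ℝ) ∞ (fun β j => φ.qT j β) α :=
    contMDiffAt_pi_space.2 fun j => φ.contMDiffAt_qT hα j
  have h2 : ContMDiffAt (IT n) 𝓘(ℝ, Fin n → ℝ) ∞ (fun β (i : Fin n) => φ.pT i.succ β) α :=
    contMDiffAt_pi_space.2 fun i => φ.contMDiffAt_pT hα i.succ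
  exact ((EuclideanSpace.equiv (Fin (n + 1)) ℝ).symm.contDiff.contDiffAt.contMDiffAt.comp α
    h1).prodMk_space ((EuclideanSpace.equiv (Fin n) ℝ).symm.contDiff.contDiffAt.contMDiffAt.comp α h2)

theorem mfderiv_coordMu {α : TStar n M} (hα : α.1 ∈ φ.chart.source) (v : TangentSpace (IT n) α) :
    mfderiv (IT n) 𝓘(ℝ, Model n × Momenta n) φ.coordMu α v = φ.dCoordMu α v := by
  have h1 := ((φ.contMDiffAt_coordMu hα).mdifferentiableAt (by simp)).hasMFDerivAt
  have h2 (l : Model n × Momenta n →L[ℝ] ℝ) :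
      differential (IT n) (fun β => l (φ.coordMu β)) α v =
        l (mfderiv (IT n) 𝓘(ℝ, Model n × Momenta n) φ.coordMu α v) :=
    DFunLike.congr_fun (l.hasMFDerivAt.comp α h1).mfderiv v
  refine Prod.ext ?_ ?_
  · ext j
    exact (h2 ((EuclideanSpace.proj (𝕜 := ℝ) j).comp
      (ContinuousLinearMap.fst ℝ (Model n) (Momenta n)))).symm
  · ext j
    exact (h2 ((EuclideanSpace.proj (𝕜 := ℝ) j).comp
      (ContinuousLinearMap.snd ℝ (Model n) (Momenta n)))).symm

theorem differential_comp_coordMu {α : TStar n M} (hα : α.1 ∈ φ.chart.source)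
    {k : Model n × Momenta n → ℝ} (hk : DifferentiableAt ℝ k (φ.coordMu α))
    (v : TangentSpace (IT n) α) :
    differential (IT n) (fun β => k (φ.coordMu β)) α v =
      fderiv ℝ k (φ.coordMu α) (φ.dCoordMu α v) := by
  have h1 := ((φ.contMDiffAt_coordMu hα).mdifferentiableAt (by simp)).hasMFDerivAt
  rw [← φ.mfderiv_coordMu hα]
  exact DFunLike.congr_fun (hk.hasFDerivAt.hasMFDerivAt.comp α h1).mfderiv v

omit [IsManifold (𝓡 (n + 1)) ∞ M] in
theorem coordMu_mem {α : TStar n M} (hα : α.1 ∈ φ.chart.source) :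
    (φ.coordMu α).1 ∈ φ.chart.target := φ.chart.map_source hα

/-- `dF_h = dp + (∂H/∂t) dt + ∑ ((∂H/∂qⁱ) dqⁱ + (∂H/∂pᵢ) dpᵢ)`. -/
theorem differential_energy {α : TStar n M} (hα : α.1 ∈ φ.chart.source)
    (v : TangentSpace (IT n) α) :
    differential (IT n) h.energy α v = differential (IT n) (φ.pT 0) α v +
      (φ.hamT h (φ.coordMu α) * differential (IT n) (φ.qT 0) α v +
      ∑ i : Fin n, (φ.hamQ h i (φ.coordMu α) * differential (IT n) (φ.qT i.succ) α v +
        φ.hamP h i (φ.coordMu α) * differential (IT n) (φ.pT i.succ) α v)) := by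
  have hH := (φ.contDiffAt_ham h (φ.coordMu_mem hα)).differentiableAt (by simp)
  have h1 := ((φ.contMDiffAt_pT hα 0).mdifferentiableAt (by simp)).hasMFDerivAt
  have h2 := hH.hasFDerivAt.hasMFDerivAt.comp α
    ((φ.contMDiffAt_coordMu hα).mdifferentiableAt (by simp)).hasMFDerivAt
  have h3 : h.energy =ᶠ[𝓝 α] φ.pT 0 + φ.ham h ∘ φ.coordMu := by
    filter_upwards [φ.eventually_mem_source hα] with β hβ
    exact φ.energy_eq h hβ
  have h4 : differential (IT n) h.energy α v = differential (IT n) (φ.pT 0) α v +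
      differential (IT n) (fun β => φ.ham h (φ.coordMu β)) α v := by
    rw [differential, h3.mfderiv_eq, (h1.add h2).mfderiv]
    exact congrArg _ (DFunLike.congr_fun h2.mfderiv v).symm
  rw [h4, φ.differential_comp_coordMu hα hH, linear_eq_sum]
  rfl

end Fibration.AdaptedChart

/-! ### The Hamilton equations on `T(T*M)` -/

/-- Since `b̃_π(z)` lies over the base point of `z`, it can only be the value of `dF_h` there. -/
theorem Fibration.HamiltonianSection.mem_STilde_iff {P : Fibration n M}
    (h : P.HamiltonianSection) {z : TangentBundle (IT n) (TStar n M)} :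
    z ∈ h.STilde ↔ dot (IT n) P.projT z = 1 ∧
      ∀ w : TangentSpace (IT n) z.1,
        canonicalForm z.1 z.2 w = differential (IT n) h.energy z.1 w := by
  constructor
  · rintro ⟨⟨z, hz⟩, ⟨α, hα⟩, rfl⟩
    refine ⟨hz, ?_⟩
    obtain rfl : α = z.1 := congrArg TotalSpace.proj hα
    have hα' : (⟨z.1, mfderiv (IT n) 𝓘(ℝ, ℝ) h.energy z.1⟩ : CotangentBundle (TStar n M) (IT n)) =
      ⟨z.1, canonicalForm z.1 z.2⟩ := hα
    have h1 := TotalSpace.mk_inj.1 hα'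
    intro w
    exact (DFunLike.congr_fun h1 w).symm
  · rintro ⟨h1, h2⟩
    refine ⟨⟨z, h1⟩, ⟨z.1, ?_⟩, rfl⟩
    exact congrArg (TotalSpace.mk z.1) (ContinuousLinearMap.ext fun w => (h2 w).symm)

namespace Fibration.AdaptedChart

variable {P : Fibration n M} (φ : P.AdaptedChart) (h : P.HamiltonianSection)

theorem dot_projT {z : TangentBundle (IT n) (TStar n M)} (hz : z ∈ φ.domTT) :
    dot (IT n) P.projT z = dot (IT n) (φ.qT 0) z := by
  have h1 : P.projT =ᶠ[𝓝 z.1] φ.qT 0 := by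
    filter_upwards [φ.eventually_mem_source hz] with β hβ
    exact (φ.time_eq _ hβ).symm
  rw [dot, h1.mfderiv_eq]
  rfl

theorem isOpen_domTT : IsOpen φ.domTT :=
  φ.isOpen_source.preimage continuous_tangent_proj

theorem eventually_dot_projT {z : TangentBundle (IT n) (TStar n M)} (hz : z ∈ φ.domTT) :
    dot (IT n) P.projT =ᶠ[𝓝 z] dot (IT n) (φ.qT 0) := by
  filter_upwards [φ.isOpen_domTT.mem_nhds hz] with z' hz'
  exact φ.dot_projT hz'

theorem hamEqs_eq_zero_iff {z : TangentBundle (IT n) (TStar n M)} (hz : z ∈ φ.domTT) :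
    φ.hamEqs h z = 0 ↔
      (∀ i : Fin n, dot (IT n) (φ.qT i.succ) z = φ.hamP h i (φ.coordMu z.1)) ∧
      (∀ i : Fin n, dot (IT n) (φ.pT i.succ) z = -φ.hamQ h i (φ.coordMu z.1)) ∧
      dot (IT n) (φ.pT 0) z = -φ.hamT h (φ.coordMu z.1) := by
  rw [← φ.coordV_mu hz]
  constructor
  · intro h0
    refine ⟨fun i => ?_, fun i => ?_, ?_⟩
    · exact sub_eq_zero.1 (congrFun h0 (.inl (.inl i)))
    · exact eq_neg_of_add_eq_zero_left (congrFun h0 (.inl (.inr i)))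
    · exact eq_neg_of_add_eq_zero_left (congrFun h0 (.inr ()))
  · rintro ⟨h1, h2, h3⟩
    funext i
    rcases i with (i | i) | i
    · exact sub_eq_zero.2 (h1 i)
    · exact add_eq_zero_iff_eq_neg.2 (h2 i)
    · exact add_eq_zero_iff_eq_neg.2 h3

/-- Over the domain of an adapted chart, the equation `Ω(z, ·) = dF_h` for a 1-jet `z` is equivalent
to the Hamilton equations with the accompanying equation for `p`: as `ṫ = 1`, the coefficients of
`dp` on both sides agree, and the other coefficients give the equations. -/
theorem canonicalForm_eq_differential_energy_iff {z : TangentBundle (IT n) (TStar n M)}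
    (hz : z ∈ φ.domTT) (h1 : dot (IT n) P.projT z = 1) :
    (∀ w : TangentSpace (IT n) z.1,
      canonicalForm z.1 z.2 w = differential (IT n) h.energy z.1 w) ↔ φ.hamEqs h z = 0 := by
  rw [φ.dot_projT hz] at h1
  have hs (a b : Fin (n + 1) → ℝ) : ∃ w : TangentSpace (IT n) z.1,
      (∀ j, differential (IT n) (φ.qT j) z.1 w = a j) ∧
        ∀ j, differential (IT n) (φ.pT j) z.1 w = b j := by
    obtain ⟨w, hw⟩ := φ.exists_tangent_coordT hz (Sum.elim a b)
    exact ⟨w, fun j => hw (.inl j), fun j => hw (.inr j)⟩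
  refine Iff.trans (forall_congr' fun w => ?_) ((wedge_eq_iff hs
    (u := fun j => dot (IT n) (φ.qT j) z) (v := fun j => dot (IT n) (φ.pT j) z) h1
    (Ht := φ.hamT h (φ.coordMu z.1)) (Hq := fun i => φ.hamQ h i (φ.coordMu z.1))
    (Hp := fun i => φ.hamP h i (φ.coordMu z.1))).trans (φ.hamEqs_eq_zero_iff h hz).symm)
  rw [φ.canonicalForm_eq hz, φ.differential_energy h hz]
  rfl

theorem mem_STilde_iff {z : TangentBundle (IT n) (TStar n M)} (hz : z ∈ φ.domTT) :
    z ∈ h.STilde ↔ dot (IT n) P.projT z = 1 ∧ φ.hamEqs h z = 0 := by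
  rw [h.mem_STilde_iff]
  exact and_congr_right fun h1 => φ.canonicalForm_eq_differential_energy_iff h hz h1

/-- The differential of `coordMu` on the projection of a vector tangent to `T(T*M)`. -/
def dCoordTT (z : TangentBundle (IT n) (TStar n M)) (w : TangentSpace (IT n).tangent z) :
    Model n × Momenta n :=
  φ.dCoordMu z.1 (mfderiv (IT n).tangent (IT n)
    (TotalSpace.proj : TangentBundle (IT n) (TStar n M) → TStar n M) z w)

theorem dCoordTT_fst {z : TangentBundle (IT n) (TStar n M)} (hz : z ∈ φ.domTT)
    (w : TangentSpace (IT n).tangent z) (j : Fin (n + 1)) : (φ.dCoordTT z w).1 j =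
      differential (IT n).tangent (fun z' : TangentBundle (IT n) (TStar n M) => φ.qT j z'.1) z w :=
  (differential_comp_proj ((φ.contMDiffAt_qT hz j).mdifferentiableAt (by simp)) w).symm

theorem dCoordTT_snd {z : TangentBundle (IT n) (TStar n M)} (hz : z ∈ φ.domTT)
    (w : TangentSpace (IT n).tangent z) (i : Fin n) : (φ.dCoordTT z w).2 i =
      differential (IT n).tangent (fun z' : TangentBundle (IT n) (TStar n M) => φ.pT i.succ z'.1)
        z w :=
  (differential_comp_proj ((φ.contMDiffAt_pT hz i.succ).mdifferentiableAt (by simp)) w).symm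

theorem contMDiffAt_comp_coordMu_proj {z : TangentBundle (IT n) (TStar n M)} (hz : z ∈ φ.domTT)
    {k : Model n × Momenta n → ℝ} (hk : ContDiffAt ℝ ∞ k (φ.coordMu z.1)) :
    ContMDiffAt (IT n).tangent 𝓘(ℝ, ℝ) ∞
      (fun z' : TangentBundle (IT n) (TStar n M) => k (φ.coordMu z'.1)) z := by
  have hp : ContMDiffAt (IT n).tangent (IT n) ∞
      (TotalSpace.proj : TangentBundle (IT n) (TStar n M) → TStar n M) z :=
    contMDiffAt_proj (TangentSpace (IT n) : TStar n M → Type _)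
  exact hk.contMDiffAt.comp z ((φ.contMDiffAt_coordMu hz).comp z hp)

theorem differential_comp_coordMu_proj {z : TangentBundle (IT n) (TStar n M)} (hz : z ∈ φ.domTT)
    {k : Model n × Momenta n → ℝ} (hk : ContDiffAt ℝ ∞ k (φ.coordMu z.1))
    (w : TangentSpace (IT n).tangent z) :
    differential (IT n).tangent
      (fun z' : TangentBundle (IT n) (TStar n M) => k (φ.coordMu z'.1)) z w =
        fderiv ℝ k (φ.coordMu z.1) (φ.dCoordTT z w) := by
  have h1 : MDifferentiableAt (IT n) 𝓘(ℝ, ℝ) (fun β => k (φ.coordMu β)) z.1 :=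
    (hk.contMDiffAt.comp z.1 (φ.contMDiffAt_coordMu hz)).mdifferentiableAt (by simp)
  rw [differential_comp_proj h1, φ.differential_comp_coordMu hz (hk.differentiableAt (by simp))]
  rfl

theorem contDiffAt_fderiv_ham {y : Model n × Momenta n} (hy : y.1 ∈ φ.chart.target)
    (e : Model n × Momenta n) : ContDiffAt ℝ ∞ (fun y => fderiv ℝ (φ.ham h) y e) y :=
  ((φ.contDiffAt_ham h hy).fderiv_right (m := ∞) (by simp)).clm_apply contDiffAt_const

theorem fderiv_fderiv_ham {y : Model n × Momenta n} (hy : y.1 ∈ φ.chart.target)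
    (e x : Model n × Momenta n) : fderiv ℝ (fun y => fderiv ℝ (φ.ham h) y e) y x =
      fderiv ℝ (fderiv ℝ (φ.ham h)) y x e := by
  have h1 := (((φ.contDiffAt_ham h hy).fderiv_right (m := ∞) (by simp)).differentiableAt
    (by simp)).hasFDerivAt.clm_apply (hasFDerivAt_const e y)
  rw [h1.fderiv]
  simp

theorem contMDiffAt_hamEqs {z : TangentBundle (IT n) (TStar n M)} (hz : z ∈ φ.domTT)
    (k : (Fin n ⊕ Fin n) ⊕ Unit) :
    ContMDiffAt (IT n).tangent 𝓘(ℝ, ℝ) ∞ (fun z => φ.hamEqs h z k) z := by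
  have hc : ∀ᶠ z' in 𝓝 z, φ.coordV (P.mu z'.1) = φ.coordMu z'.1 := by
    filter_upwards [φ.isOpen_domTT.mem_nhds hz] with z' hz'
    exact φ.coordV_mu hz'
  have hk (e) := φ.contMDiffAt_comp_coordMu_proj hz
    (φ.contDiffAt_fderiv_ham h (φ.coordMu_mem hz) e)
  rcases k with (i | i) | i
  · refine ((contMDiffAt_dot (φ.contMDiffAt_qT hz i.succ)).sub
      (hk (0, EuclideanSpace.single i 1))).congr_of_eventuallyEq ?_
    filter_upwards [hc] with z' hz'
    simp only [hamEqs, hamP, hz']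
  · refine ((contMDiffAt_dot (φ.contMDiffAt_pT hz i.succ)).add
      (hk (EuclideanSpace.single i.succ 1, 0))).congr_of_eventuallyEq ?_
    filter_upwards [hc] with z' hz'
    simp only [hamEqs, hamQ, hz']
    rfl
  · refine ((contMDiffAt_dot (φ.contMDiffAt_pT hz 0)).add
      (hk (EuclideanSpace.single 0 1, 0))).congr_of_eventuallyEq ?_
    filter_upwards [hc] with z' hz'
    simp only [hamEqs, hamT, hz']
    rfl

end Fibration.AdaptedChart

/-! ### Independence of the Hamilton equations and the tangent space of `S̃_h` -/

namespace Fibration.AdaptedChart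

variable {P : Fibration n M} (φ : P.AdaptedChart) (h : P.HamiltonianSection)
  {z : TangentBundle (IT n) (TStar n M)}

theorem eventually_coordV_mu (hz : z ∈ φ.domTT) :
    ∀ᶠ z' in 𝓝 z, φ.coordV (P.mu z'.1) = φ.coordMu z'.1 := by
  filter_upwards [φ.isOpen_domTT.mem_nhds hz] with z' hz'
  exact φ.coordV_mu hz'

/-- The second derivative of the local Hamiltonian at the point of `V*π` below `z`. -/
def hess (z : TangentBundle (IT n) (TStar n M)) :
    Model n × Momenta n →L[ℝ] Model n × Momenta n →L[ℝ] ℝ :=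
  fderiv ℝ (fderiv ℝ (φ.ham h)) (φ.coordMu z.1)

theorem hess_symm (hz : z ∈ φ.domTT) (x y : Model n × Momenta n) :
    φ.hess h z x y = φ.hess h z y x := by
  refine ((φ.contDiffAt_ham h (φ.coordMu_mem hz)).isSymmSndFDerivAt ?_) x y
  rw [minSmoothness_of_isRCLikeNormedField]
  exact ENat.LEInfty.out

/-- The differential of `f + ∂H` for a partial derivative `∂H` of the local Hamiltonian, the
common shape of the three families in `hamEqs`. -/
theorem differential_add_fderiv_ham (hz : z ∈ φ.domTT) {f F : TangentBundle (IT n) (TStar n M) → ℝ}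
    (hf : ContMDiffAt (IT n).tangent 𝓘(ℝ, ℝ) ∞ f z) {e : Model n × Momenta n}
    (hF : ∀ z', F z' = f z' + fderiv ℝ (φ.ham h) (φ.coordV (P.mu z'.1)) e)
    (w : TangentSpace (IT n).tangent z) :
    differential (IT n).tangent F z w =
      differential (IT n).tangent f z w + φ.hess h z (φ.dCoordTT z w) e := by
  have hk := φ.contDiffAt_fderiv_ham h (φ.coordMu_mem hz) e
  have h1 := differential_congr_add (hf.mdifferentiableAt (by simp))
    ((φ.contMDiffAt_comp_coordMu_proj hz hk).mdifferentiableAt (by simp)) (F := F)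
    ((φ.eventually_coordV_mu hz).mono fun z' hz' => by rw [hF, hz']) w
  have h2 := φ.differential_comp_coordMu_proj hz hk w
  have h3 := φ.fderiv_fderiv_ham h (φ.coordMu_mem hz) e (φ.dCoordTT z w)
  exact h1.trans (congrArg _ (h2.trans h3))

theorem differential_hamEqs_p (hz : z ∈ φ.domTT) (i : Fin n) (w : TangentSpace (IT n).tangent z) :
    differential (IT n).tangent (fun z => φ.hamEqs h z (.inl (.inr i))) z w =
      differential (IT n).tangent (dot (IT n) (φ.pT i.succ)) z w +
        φ.hess h z (φ.dCoordTT z w) (EuclideanSpace.single i.succ 1, 0) :=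
  φ.differential_add_fderiv_ham h hz (contMDiffAt_dot (φ.contMDiffAt_pT hz i.succ))
    (fun _ => rfl) w

theorem differential_hamEqs_time (hz : z ∈ φ.domTT) (w : TangentSpace (IT n).tangent z) :
    differential (IT n).tangent (fun z => φ.hamEqs h z (.inr ())) z w =
      differential (IT n).tangent (dot (IT n) (φ.pT 0)) z w +
        φ.hess h z (φ.dCoordTT z w) (EuclideanSpace.single 0 1, 0) :=
  φ.differential_add_fderiv_ham h hz (contMDiffAt_dot (φ.contMDiffAt_pT hz 0)) (fun _ => rfl) w

theorem differential_hamEqs_q (hz : z ∈ φ.domTT) (i : Fin n) (w : TangentSpace (IT n).tangent z) :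
    differential (IT n).tangent (fun z => φ.hamEqs h z (.inl (.inl i))) z w =
      differential (IT n).tangent (dot (IT n) (φ.qT i.succ)) z w -
        φ.hess h z (φ.dCoordTT z w) (0, EuclideanSpace.single i 1) := by
  have h1 := φ.differential_add_fderiv_ham h hz (contMDiffAt_dot (φ.contMDiffAt_qT hz i.succ))
    (e := -(0, EuclideanSpace.single i 1)) (F := fun z => φ.hamEqs h z (.inl (.inl i)))
    (fun _ => (sub_eq_add_neg _ _).trans (congrArg _ (map_neg _ _).symm)) w
  exact h1.trans ((congrArg _ (map_neg _ _)).trans (sub_eq_add_neg _ _).symm)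

/-- The coordinates `(t, qⁱ, p, pᵢ; ṫ, q̇ⁱ, ṗ, ṗᵢ)` of `T(T*M)` have independent differentials. -/
theorem exists_tangent_coordTT (hz : z ∈ φ.domTT) (a b c d : Fin (n + 1) → ℝ) :
    ∃ w : TangentSpace (IT n).tangent z,
      (∀ j, differential (IT n).tangent
        (fun z' : TangentBundle (IT n) (TStar n M) => φ.qT j z'.1) z w = a j) ∧
      (∀ j, differential (IT n).tangent
        (fun z' : TangentBundle (IT n) (TStar n M) => φ.pT j z'.1) z w = b j) ∧
      (∀ j, differential (IT n).tangent (dot (IT n) (φ.qT j)) z w = c j) ∧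
      ∀ j, differential (IT n).tangent (dot (IT n) (φ.pT j)) z w = d j :=
  exists_tangent_dot (φ.contMDiffAt_qT hz) (φ.contMDiffAt_pT hz) (φ.exists_tangent_coordT hz)
    a b c d

theorem differential_dot_projT (hz : z ∈ φ.domTT) (w : TangentSpace (IT n).tangent z) :
    differential (IT n).tangent (dot (IT n) P.projT) z w =
      differential (IT n).tangent (dot (IT n) (φ.qT 0)) z w :=
  DFunLike.congr_fun (φ.eventually_dot_projT hz).mfderiv_eq w

theorem mem_levelTangent_iff (hz : z ∈ φ.domTT) (w : TangentSpace (IT n).tangent z) :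
    w ∈ levelTangent (IT n).tangent (dot (IT n) P.projT) z ↔
      differential (IT n).tangent (dot (IT n) (φ.qT 0)) z w = 0 := by
  rw [← φ.differential_dot_projT hz w]
  exact LinearMap.mem_ker

theorem dCoordTT_eq_zero (hz : z ∈ φ.domTT) {w : TangentSpace (IT n).tangent z}
    (hq : ∀ j, differential (IT n).tangent
        (fun z' : TangentBundle (IT n) (TStar n M) => φ.qT j z'.1) z w = 0)
    (hp : ∀ i : Fin n, differential (IT n).tangent
        (fun z' : TangentBundle (IT n) (TStar n M) => φ.pT i.succ z'.1) z w = 0) :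
    φ.dCoordTT z w = 0 := by
  refine Prod.ext ?_ ?_
  · ext j
    exact (φ.dCoordTT_fst hz w j).trans (hq j)
  · ext i
    exact (φ.dCoordTT_snd hz w i).trans (hp i)

/-- The differentials of the functions `hamEqs` are independent even on the vectors tangent to the
fibres of `T(T*M) → T*M`. -/
theorem exists_differential_hamEqs_eq (hz : z ∈ φ.domTT) (c : (Fin n ⊕ Fin n) ⊕ Unit → ℝ) :
    ∃ w : TangentSpace (IT n).tangent z,
      differential (IT n).tangent (dot (IT n) P.projT) z w = 0 ∧
      ∀ k, differential (IT n).tangent (fun z => φ.hamEqs h z k) z w = c k := by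
  let a : Fin (n + 1) → ℝ := Fin.cons 0 fun i => c (.inl (.inl i))
  let b : Fin (n + 1) → ℝ := Fin.cons (c (.inr ())) fun i => c (.inl (.inr i))
  obtain ⟨w, hw1, hw2, hw3, hw4⟩ := φ.exists_tangent_coordTT hz (fun _ => 0) (fun _ => 0) a b
  have h0 : φ.dCoordTT z w = 0 := φ.dCoordTT_eq_zero hz hw1 fun i => hw2 i.succ
  have h1 (e) : φ.hess h z (φ.dCoordTT z w) e = 0 := by
    rw [h0]
    exact DFunLike.congr_fun (map_zero (φ.hess h z)) e
  have aux {x y r s : ℝ} (hx : x = y + r) (hy : y = s) (hr : r = 0) : x = s := by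
    rw [hx, hy, hr, add_zero]
  have aux' {x y r s : ℝ} (hx : x = y - r) (hy : y = s) (hr : r = 0) : x = s := by
    rw [hx, hy, hr, sub_zero]
  have hq (i) := aux' (φ.differential_hamEqs_q h hz i w) (hw3 i.succ) (h1 _)
  have hp (i) := aux (φ.differential_hamEqs_p h hz i w) (hw4 i.succ) (h1 _)
  have ht := aux (φ.differential_hamEqs_time h hz w) (hw4 0) (h1 _)
  refine ⟨w, (φ.differential_dot_projT hz w).trans (hw3 0), Sum.forall.2 ⟨Sum.forall.2
    ⟨hq, hp⟩, fun _ => ht⟩⟩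

theorem definingEquations_hamEqs :
    DefiningEquations (IT n).tangent (dot (IT n) P.projT) h.STilde φ.domTT (φ.hamEqs h) :=
  definingEquations_of_differential φ.isOpen_domTT (fun _ hz => φ.contMDiffAt_hamEqs h hz)
    (fun _ hz => φ.mem_STilde_iff h hz) fun _ hz => φ.exists_differential_hamEqs_eq h hz

/-- The tangent space of `S̃_h`, by the linearized Hamilton equations. -/
theorem mem_curveTangent_STilde_iff (hz : z ∈ φ.domTT) (hS : z ∈ h.STilde)
    (w : TangentSpace (IT n).tangent z) :
    w ∈ curveTangent (IT n).tangent h.STilde z ↔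
      differential (IT n).tangent (dot (IT n) (φ.qT 0)) z w = 0 ∧
      (∀ i : Fin n, differential (IT n).tangent (dot (IT n) (φ.qT i.succ)) z w =
        φ.hess h z (φ.dCoordTT z w) (0, EuclideanSpace.single i 1)) ∧
      ∀ j, differential (IT n).tangent (dot (IT n) (φ.pT j)) z w =
        -φ.hess h z (φ.dCoordTT z w) (EuclideanSpace.single j 1, 0) := by
  have hd : ∃ w, differential (IT n).tangent (dot (IT n) P.projT) z w = 1 := by
    obtain ⟨w, -, -, hw, -⟩ := φ.exists_tangent_coordTT hz 0 0 1 0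
    exact ⟨w, (φ.differential_dot_projT hz w).trans (hw 0)⟩
  have hg : ContMDiffAt (IT n).tangent 𝓘(ℝ, ℝ) ∞ (dot (IT n) P.projT) z :=
    contMDiffAt_dot P.contMDiff_projT.contMDiffAt
  refine ((φ.definingEquations_hamEqs h).mem_curveTangent_iff ⟨hS, hz⟩ hg hd w).trans ?_
  refine and_congr (by rw [φ.differential_dot_projT hz w]) ?_
  constructor
  · intro h2
    refine ⟨fun i => ?_, fun j => ?_⟩
    · exact sub_eq_zero.1 ((φ.differential_hamEqs_q h hz i w).symm.trans (h2 _))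
    · refine Fin.cases ?_ (fun i => ?_) j
      · exact eq_neg_of_add_eq_zero_left
          ((φ.differential_hamEqs_time h hz w).symm.trans (h2 _))
      · exact eq_neg_of_add_eq_zero_left ((φ.differential_hamEqs_p h hz i w).symm.trans (h2 _))
  · rintro ⟨h2, h3⟩ ((i | i) | i)
    · exact (φ.differential_hamEqs_q h hz i w).trans (sub_eq_zero.2 (h2 i))
    · exact (φ.differential_hamEqs_p h hz i w).trans (add_eq_zero_iff_eq_neg.2 (h3 i.succ))
    · exact (φ.differential_hamEqs_time h hz w).trans (add_eq_zero_iff_eq_neg.2 (h3 0))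

end Fibration.AdaptedChart

/-! ### The Lagrangian property of `S̃_h` -/

namespace Fibration.AdaptedChart

variable {P : Fibration n M} (φ : P.AdaptedChart) (h : P.HamiltonianSection)
  {z : TangentBundle (IT n) (TStar n M)}

/-- The complete lift of the canonical form is `∑ (dq̇ⱼ ∧ dpⱼ + dqⱼ ∧ dṗⱼ)`, with `q₀ = t` and
`p₀ = p`. -/
theorem completeLift_canonicalForm_eq (hz : z ∈ φ.domTT) (v w : TangentSpace (IT n).tangent z) :
    completeLift canonicalForm z v w = ∑ j,
      (differential (IT n).tangent (dot (IT n) (φ.qT j)) z v * differential (IT n).tangent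
          (fun z' : TangentBundle (IT n) (TStar n M) => φ.pT j z'.1) z w -
        differential (IT n).tangent (dot (IT n) (φ.qT j)) z w * differential (IT n).tangent
          (fun z' : TangentBundle (IT n) (TStar n M) => φ.pT j z'.1) z v +
        (differential (IT n).tangent
            (fun z' : TangentBundle (IT n) (TStar n M) => φ.qT j z'.1) z v *
          differential (IT n).tangent (dot (IT n) (φ.pT j)) z w -
        differential (IT n).tangent
            (fun z' : TangentBundle (IT n) (TStar n M) => φ.qT j z'.1) z w *
          differential (IT n).tangent (dot (IT n) (φ.pT j)) z v)) :=
  completeLift_eq_sum (φ.contMDiffAt_qT hz) (φ.contMDiffAt_pT hz)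
    ((φ.eventually_mem_source hz).mono fun _ hβ => φ.canonicalForm_eq hβ) v w

/-- `S̃_h` is isotropic. -/
theorem completeLift_eq_zero (hz : z ∈ φ.domTT) (hS : z ∈ h.STilde)
    {v w : TangentSpace (IT n).tangent z} (hv : v ∈ curveTangent (IT n).tangent h.STilde z)
    (hw : w ∈ curveTangent (IT n).tangent h.STilde z) : completeLift canonicalForm z v w = 0 := by
  have hv' := (φ.mem_curveTangent_STilde_iff h hz hS v).1 hv
  have hw' := (φ.mem_curveTangent_STilde_iff h hz hS w).1 hw
  let q (u : TangentSpace (IT n).tangent z) (j : Fin (n + 1)) : ℝ := differential (IT n).tangent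
    (fun z' : TangentBundle (IT n) (TStar n M) => φ.qT j z'.1) z u
  let p (u : TangentSpace (IT n).tangent z) (j : Fin (n + 1)) : ℝ := differential (IT n).tangent
    (fun z' : TangentBundle (IT n) (TStar n M) => φ.pT j z'.1) z u
  let q' (u : TangentSpace (IT n).tangent z) (j : Fin (n + 1)) : ℝ :=
    differential (IT n).tangent (dot (IT n) (φ.qT j)) z u
  let p' (u : TangentSpace (IT n).tangent z) (j : Fin (n + 1)) : ℝ :=
    differential (IT n).tangent (dot (IT n) (φ.pT j)) z u
  have h1 := sum_wedge_eq_zero (q := q v) (p := p v) (q' := q' v) (p' := p' v) (r := q w)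
    (s := p w) (r' := q' w) (s' := p' w) (φ.hess_symm h hz)
    (φ.dCoordTT_fst hz v) (φ.dCoordTT_snd hz v) hv'.1 hv'.2.1 hv'.2.2
    (φ.dCoordTT_fst hz w) (φ.dCoordTT_snd hz w) hw'.1 hw'.2.1 hw'.2.2
  exact (φ.completeLift_canonicalForm_eq hz v w).trans h1

theorem exists_differential_dot_projT (hz : z ∈ φ.domTT) :
    ∃ w, differential (IT n).tangent (dot (IT n) P.projT) z w = 1 := by
  obtain ⟨w, -, -, hw, -⟩ := φ.exists_tangent_coordTT hz 0 0 1 0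
  exact ⟨w, (φ.differential_dot_projT hz w).trans (hw 0)⟩

/-- The dimension condition for `S̃_h`: its tangent space has dimension `2 n + 2`, the restricted
form has rank `4 n + 2`, and its kernel, spanned by `∂/∂p`, is tangent to `S̃_h`. -/
theorem two_mul_finrank_curveTangent (hz : z ∈ φ.domTT) (hS : z ∈ h.STilde) :
    2 * Module.finrank ℝ (curveTangent (IT n).tangent h.STilde z) =
      Module.finrank ℝ (LinearMap.range (flatOn (IT n).tangent (completeLift canonicalForm z)
        (levelTangent (IT n).tangent (dot (IT n) P.projT) z))) +
      2 * Module.finrank ℝ (curveTangent (IT n).tangent h.STilde z ⊓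
        (LinearMap.ker (flatOn (IT n).tangent (completeLift canonicalForm z)
          (levelTangent (IT n).tangent (dot (IT n) P.projT) z))).map
          (levelTangent (IT n).tangent (dot (IT n) P.projT) z).subtype :
            Submodule ℝ (TangentSpace (IT n).tangent z)) := by
  have : FiniteDimensional ℝ (TangentSpace (IT n).tangent z) :=
    inferInstanceAs (FiniteDimensional ℝ
      ((Model n × (Model n →L[ℝ] ℝ)) × (Model n × (Model n →L[ℝ] ℝ))))
  refine two_mul_finrank_eq (n := n)
    (dq := fun j => (differential (IT n).tangent
      (fun z' : TangentBundle (IT n) (TStar n M) => φ.qT j z'.1) z).toLinearMap)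
    (dp := fun j => (differential (IT n).tangent
      (fun z' : TangentBundle (IT n) (TStar n M) => φ.pT j z'.1) z).toLinearMap)
    (dq' := fun j => (differential (IT n).tangent (dot (IT n) (φ.qT j)) z).toLinearMap)
    (dp' := fun j => (differential (IT n).tangent (dot (IT n) (φ.pT j)) z).toLinearMap)
    (L := LinearMap.pi fun k =>
      (differential (IT n).tangent (fun z => φ.hamEqs h z k) z).toLinearMap)
    (finrank_model_tangent n) (φ.exists_tangent_coordTT hz) (φ.mem_levelTangent_iff hz) ?_ ?_ ?_ ?_
    ?_
  · intro v
    refine (flatOn_eq_zero_iff v).trans (forall₂_congr fun w _ => ?_)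
    rw [φ.completeLift_canonicalForm_eq hz]
    rfl
  · simp [two_mul]
  · intro c
    obtain ⟨w, hw, hc⟩ := φ.exists_differential_hamEqs_eq h hz c
    exact ⟨w, hw, funext hc⟩
  · exact (φ.definingEquations_hamEqs h).curveTangent_eq_inf_ker_pi ⟨hS, hz⟩
      (contMDiffAt_dot P.contMDiff_projT.contMDiffAt) (φ.exists_differential_dot_projT hz)
  · intro v hq hp hq' hp'
    have h0 : φ.dCoordTT z v = 0 := φ.dCoordTT_eq_zero hz hq hp
    have h1 (e) : φ.hess h z (φ.dCoordTT z v) e = 0 := by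
      rw [h0]
      exact DFunLike.congr_fun (map_zero (φ.hess h z)) e
    exact (φ.mem_curveTangent_STilde_iff h hz hS v).2 ⟨hq' 0, fun i => (hq' i.succ).trans (h1 _).symm,
      fun j => (hp' j).trans (neg_eq_zero.2 (h1 _)).symm⟩

end Fibration.AdaptedChart

theorem Fibration.HamiltonianSection.isLagrangianSubmanifold_STilde {P : Fibration n M}
    (h : P.HamiltonianSection) :
    IsLagrangianSubmanifold (IT n).tangent (dot (IT n) P.projT) (completeLift canonicalForm)
      h.STilde where
  subset _ hz := (h.mem_STilde_iff.1 hz).1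
  submanifold z _ :=
    ⟨(P.adaptedChartAt z.1.1).domTT, P.mem_adaptedChartAt z.1.1, _, _,
      ((P.adaptedChartAt z.1.1).definingEquations_hamEqs h).reindex (Fintype.equivFin _).symm⟩
  isotropic z hz _ hv _ hw := (P.adaptedChartAt z.1.1).completeLift_eq_zero h
    (P.mem_adaptedChartAt z.1.1) hz hv hw
  dim_eq z hz := (P.adaptedChartAt z.1.1).two_mul_finrank_curveTangent h
    (P.mem_adaptedChartAt z.1.1) hz

/-! ### Solutions of the Hamilton equations -/

variable {P : Fibration n M} (h : P.HamiltonianSection)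
  (τ : LocalSection (IV n) P.projV)

theorem Fibration.HamiltonianSection.mdifferentiableAt_comp {t : ℝ} (ht : t ∈ τ.dom) :
    MDifferentiableAt 𝓘(ℝ, ℝ) (IT n) (h.toFun ∘ τ.toFun) t :=
  ((h.comp τ).contMDiffOn.contMDiffAt (τ.isOpen_dom.mem_nhds ht)).mdifferentiableAt (by simp)

namespace Fibration.AdaptedChart

variable (φ : P.AdaptedChart)

theorem toFun_mem_source {β : P.VStar} (hβ : β.1 ∈ φ.chart.source) :
    (h.toFun β).1 ∈ φ.chart.source := by
  rwa [toFun_fst]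

theorem coordMu_toFun {β : P.VStar} (hβ : β.1 ∈ φ.chart.source) :
    φ.coordMu (h.toFun β) = φ.coordV β := by
  rw [← φ.coordV_mu (φ.toFun_mem_source h hβ), h.section_eq]

theorem eventually_toFun_mem_source {t : ℝ} (ht : t ∈ τ.dom)
    (hs : (τ.toFun t).1 ∈ φ.chart.source) : ∀ᶠ s in 𝓝 t, (τ.toFun s).1 ∈ φ.chart.source := by
  have h1 := (τ.contMDiffOn.contMDiffAt (τ.isOpen_dom.mem_nhds ht)).continuousAt
  exact ((FiberBundle.continuous_proj (Momenta n) P.VDual).continuousAt.comp h1).eventually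
    (φ.chart.open_source.mem_nhds hs)

/-- The values along `h ∘ τ` of a coordinate `k` have derivative `k̇(j¹(h ∘ τ))`; here `f` need only
agree with these values over the domain of the chart. -/
theorem hasDerivAt_coord_comp {t : ℝ} (ht : t ∈ τ.dom) (hs : (τ.toFun t).1 ∈ φ.chart.source)
    {k : TStar n M → ℝ} (hk : ContMDiffAt (IT n) 𝓘(ℝ, ℝ) ∞ k (h.toFun (τ.toFun t))) {f : ℝ → ℝ}
    (hf : ∀ s, (τ.toFun s).1 ∈ φ.chart.source → f s = k (h.toFun (τ.toFun s))) :
    HasDerivAt f (dot (IT n) k (velocity (h.toFun ∘ τ.toFun) t)) t :=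
  (hasDerivAt_comp_velocity (γ := h.toFun ∘ τ.toFun) (hk.mdifferentiableAt (by simp))
    (h.mdifferentiableAt_comp τ ht)).congr_of_eventuallyEq
      ((φ.eventually_toFun_mem_source τ ht hs).mono hf)

/-- Along `h ∘ τ` one has `p = -H`, so the equation for `p` follows from the Hamilton equations by
the chain rule. -/
theorem dot_pT_zero {t : ℝ} (ht : t ∈ τ.dom) (hs : (τ.toFun t).1 ∈ φ.chart.source)
    (hq : ∀ i : Fin n, dot (IT n) (φ.qT i.succ) (velocity (h.toFun ∘ τ.toFun) t) =
      φ.hamP h i (φ.coordV (τ.toFun t)))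
    (hp : ∀ i : Fin n, dot (IT n) (φ.pT i.succ) (velocity (h.toFun ∘ τ.toFun) t) =
      -φ.hamQ h i (φ.coordV (τ.toFun t))) :
    dot (IT n) (φ.pT 0) (velocity (h.toFun ∘ τ.toFun) t) = -φ.hamT h (φ.coordV (τ.toFun t)) := by
  have hα := φ.toFun_mem_source h hs
  have hH := φ.contDiffAt_ham h (φ.coordMu_mem hα)
  have h1 := φ.hasDerivAt_coord_comp h τ ht hs (φ.contMDiffAt_pT hα 0)
    (f := fun s => -φ.ham h (φ.coordMu (h.toFun (τ.toFun s)))) fun s hs => by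
      rw [φ.coordMu_toFun h hs, φ.ham_coordV h hs, neg_neg]
  have h2 := (φ.hasDerivAt_coord_comp h τ ht hs (f := fun s => φ.ham h (φ.coordMu
    (h.toFun (τ.toFun s)))) (k := fun α => φ.ham h (φ.coordMu α))
    (hH.contMDiffAt.comp _ (φ.contMDiffAt_coordMu hα)) fun _ _ => rfl).fun_neg
  have h3 : dot (IT n) (fun α => φ.ham h (φ.coordMu α)) (velocity (h.toFun ∘ τ.toFun) t) =
      φ.hamT h (φ.coordMu (h.toFun (τ.toFun t))) *
        dot (IT n) (φ.qT 0) (velocity (h.toFun ∘ τ.toFun) t) +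
      ∑ i : Fin n, (φ.hamQ h i (φ.coordMu (h.toFun (τ.toFun t))) *
          dot (IT n) (φ.qT i.succ) (velocity (h.toFun ∘ τ.toFun) t) +
        φ.hamP h i (φ.coordMu (h.toFun (τ.toFun t))) *
          dot (IT n) (φ.pT i.succ) (velocity (h.toFun ∘ τ.toFun) t)) :=
    (φ.differential_comp_coordMu hα (hH.differentiableAt (by simp)) _).trans
      (linear_eq_sum _ _)
  have h4 : dot (IT n) (φ.qT 0) (velocity (h.toFun ∘ τ.toFun) t) = 1 := by
    rw [← φ.dot_projT hα]
    exact (h.comp τ).velocity_mem P.contMDiff_projT ⟨t, ht⟩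
  rw [h1.unique h2, h3, h4, φ.coordMu_toFun h hs, mul_one,
    Finset.sum_eq_zero fun i _ => by rw [hq, hp]; ring, add_zero]

/-- The 1-jet of `h ∘ τ` satisfies the equations `hamEqs` if and only if `τ` satisfies the Hamilton
equations; the equation for `p` is then automatic. -/
theorem hamEqs_velocity_eq_zero_iff {t : ℝ} (ht : t ∈ τ.dom)
    (hs : (τ.toFun t).1 ∈ φ.chart.source) :
    φ.hamEqs h (velocity (h.toFun ∘ τ.toFun) t) = 0 ↔ ∀ i : Fin n,
      HasDerivAt (fun s => φ.chart (τ.toFun s).1 i.succ) (φ.hamP h i (φ.coordV (τ.toFun t))) t ∧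
      HasDerivAt (fun s => φ.momenta (τ.toFun s) i) (-φ.hamQ h i (φ.coordV (τ.toFun t))) t := by
  have hα := φ.toFun_mem_source h hs
  have hq (i : Fin n) := φ.hasDerivAt_coord_comp h τ ht hs (φ.contMDiffAt_qT hα i.succ)
    (f := fun s => φ.chart (τ.toFun s).1 i.succ) fun s _ => by rw [qT, toFun_fst]
  have hp (i : Fin n) := φ.hasDerivAt_coord_comp h τ ht hs (φ.contMDiffAt_pT hα i.succ)
    (f := fun s => φ.momenta (τ.toFun s) i) fun s hs =>
      congrArg (fun y : Model n × Momenta n => y.2 i) (φ.coordMu_toFun h hs).symm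
  have hc : φ.coordMu (velocity (I := IT n) (h.toFun ∘ τ.toFun) t).1 = φ.coordV (τ.toFun t) :=
    φ.coordMu_toFun h hs
  rw [φ.hamEqs_eq_zero_iff h hα, hc]
  constructor
  · rintro ⟨h1, h2, -⟩ i
    exact ⟨h1 i ▸ hq i, h2 i ▸ hp i⟩
  · intro h1
    have h2 (i : Fin n) := (hq i).unique (h1 i).1
    have h3 (i : Fin n) := (hp i).unique (h1 i).2
    exact ⟨h2, h3, φ.dot_pT_zero h τ ht hs h2 h3⟩

end Fibration.AdaptedChart

theorem Fibration.HamiltonianSection.flatTilde_jet_eq_iff (φ : P.AdaptedChart) (t : τ.dom)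
    (hs : (τ.toFun t).1 ∈ φ.chart.source) :
    P.flatTilde ((h.comp τ).jet P.contMDiff_projT t) = h.dEnergy (h.toFun (τ.toFun t)) ↔
      φ.hamEqs h (velocity (h.toFun ∘ τ.toFun) t) = 0 := by
  have hα := φ.toFun_mem_source h hs
  let z : TangentBundle (IT n) (TStar n M) := velocity (h.toFun ∘ τ.toFun) t
  have h1 : dot (IT n) P.projT z = 1 := (h.comp τ).velocity_mem P.contMDiff_projT t
  refine Iff.trans ?_ (φ.canonicalForm_eq_differential_energy_iff h hα h1)
  have h2 : (⟨z.1, canonicalForm z.1 z.2⟩ : CotangentBundle (TStar n M) (IT n)) =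
      ⟨z.1, differential (IT n) h.energy z.1⟩ ↔
      canonicalForm z.1 z.2 = differential (IT n) h.energy z.1 := TotalSpace.mk_inj
  exact h2.trans DFunLike.ext_iff

theorem Fibration.HamiltonianSection.isSolution_iff :
    h.IsSolution τ ↔ P.flatTilde ∘ (h.comp τ).jet P.contMDiff_projT =
      fun t : τ.dom => h.dEnergy (h.toFun (τ.toFun t)) := by
  constructor
  · intro hsol
    funext t
    have hs := P.mem_adaptedChartAt (τ.toFun t).1
    exact (h.flatTilde_jet_eq_iff τ _ t hs).2 ((AdaptedChart.hamEqs_velocity_eq_zero_iff h τ _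
      t.2 hs).2 (hsol _ t t.2 hs))
  · intro heq φ t ht hs
    exact (φ.hamEqs_velocity_eq_zero_iff h τ ht hs).1
      ((h.flatTilde_jet_eq_iff τ φ ⟨t, ht⟩ hs).1 (congrFun heq ⟨t, ht⟩))

end TimeDep

end

theorem mainTheorem10 {n : ℕ} {M : Type*} [TopologicalSpace M]
    [ChartedSpace (TimeDep.Model n) M] [IsManifold (𝓡 (n + 1)) ∞ M]
    (P : TimeDep.Fibration n M) (h : P.HamiltonianSection) :
    (∀ τ : TimeDep.LocalSection (TimeDep.IV n) P.projV,
      h.IsSolution τ ↔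
        P.flatTilde ∘ (h.comp τ).jet P.contMDiff_projT =
          fun t : τ.dom => h.dEnergy (h.toFun (τ.toFun t))) ∧
    TimeDep.IsLagrangianSubmanifold (TimeDep.IT n).tangent
      (TimeDep.dot (TimeDep.IT n) P.projT)
      (TimeDep.completeLift TimeDep.canonicalForm) h.STilde ∧
    ∀ φ : P.AdaptedChart,
      TimeDep.DefiningEquations (TimeDep.IT n).tangent
        (TimeDep.dot (TimeDep.IT n) P.projT) h.STilde φ.domTT (φ.hamEqs h) :=
  ⟨h.isSolution_iff, h.isLagrangianSubmanifold_STilde, fun φ => φ.definingEquations_hamEqs h⟩
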